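/- Let $q\in C^1[0,\pi]$ be complex-valued and $a=\pi/2$. For $m\in\mathbb N$ put $l=2m-1$, $h=\frac{\pi}{l+1}=\frac{\pi}{2m}$, $x_j=jh$, $q_j=q(x_j)$ for $0\le j\le l+1$ (so that $x_m=a$), and consider the discrete eigenvalue problem $$-\frac{y_{j+1}-2y_j+y_{j-1}}{h^2}+q_jy_m=\lambda y_j,\quad j=1,\dots,l,\qquad y_0=y_{l+1}=0.$$ Then for every $m$ its eigenvalues, counted with algebraic multiplicity, can be numbered as $\lambda_{1,l},\dots,\lambda_{l,l}$ in such a way that $\lambda_{n,l}=\frac{4\sin^2(nh/2)}{h^2}$ for all even $n$ and such that the following holds for every fixed $\alpha>0$. (i) (Numbering.) For every $\delta\in(0,\pi/2)$, for all sufficiently large $m$ and all odd $n\in\{1,\dots,l\}$ with $\frac{n}{2m}\ge\alpha$, the disc $|\theta-\frac{\pi n}{2m}|<\frac{\delta}{l}$ in $\mathbb C$ contains exactly one $\theta$ for which $\frac{2-2\cos\theta}{h^2}$ is an eigenvalue; this eigenvalue is simple and equal to $\lambda_{n,l}$. (ii) (Asymptotics.) As $l=2m-1\to\infty$, $$\lambda_{n,l}=\frac{4\sin^2\left(\frac{nh}{2}\right)}{h^2}+\frac{2}{\pi}\sin\left(\frac{n\pi}{2}\right)\Bigl(h\sum_{j=0}^{m}{}^{'}p_j\sin(nx_j)\Bigr)+O(h),$$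 uniformly with respect to odd $n\in\{1,\dots,l\}$ with $\frac{n}{2m}\ge\alpha$; that is, there are $C$ and $M$ depending only on $q$ and $\alpha$ such that for all $m\ge M$ and all such $n$ the remainder is at most $Ch$ in absolute value. Here $p_j=p(x_j)$, $p(x)=q(x)+q(\pi-x)$, and $\sum_{j=0}^{m}{}^{'}a_j=\frac12a_0+\sum_{j=1}^{m-1}a_j+\frac12a_m$. -/

import Mathlib

/-- The mesh size `h = π / (l + 1)`. -/
noncomputable def meshSize (l : ℕ) : ℝ := Real.pi / ((l : ℝ) + 1)

/-- The grid points `x_j = j h`. -/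
noncomputable def gridPoint (l j : ℕ) : ℝ := (j : ℝ) * meshSize l

/-- The grid function `y_0, y_1, y_2, …` that has the values `y_1, …, y_l` given by
`v : Fin l → ℂ` (the value `y_j` is stored at position `j - 1`) and vanishes elsewhere; in
particular it satisfies the boundary conditions `y_0 = y_{l+1} = 0`. -/
def dirichletExtend {l : ℕ} (v : Fin l → ℂ) (j : ℕ) : ℂ :=
  if hj : 1 ≤ j ∧ j ≤ l then v ⟨j - 1, by omega⟩ else 0

theorem dirichletExtend_add {l : ℕ} (v w : Fin l → ℂ) (j : ℕ) :
    dirichletExtend (v + w) j = dirichletExtend v j + dirichletExtend w j := by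
  unfold dirichletExtend; split_ifs <;> simp

theorem dirichletExtend_smul {l : ℕ} (c : ℂ) (v : Fin l → ℂ) (j : ℕ) :
    dirichletExtend (c • v) j = c * dirichletExtend v j := by
  unfold dirichletExtend; split_ifs <;> simp

/-- The finite-difference Sturm–Liouville operator with frozen argument at the grid point `x_m`:
it sends `(y_1, …, y_l)` to the vector whose `j`-th entry (`j = i + 1`, `1 ≤ j ≤ l`) is
`-(y_{j+1} - 2 y_j + y_{j-1}) / h² + q(x_j) y_m`, where `y_0 = y_{l+1} = 0`. -/
noncomputable def frozenOperator (q : ℝ → ℂ) (l m : ℕ) : (Fin l → ℂ) →ₗ[ℂ] (Fin l → ℂ) where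
  toFun v i :=
    -(dirichletExtend v (i + 2) - 2 * dirichletExtend v (i + 1) + dirichletExtend v i)
        / (meshSize l : ℂ) ^ 2
      + q (gridPoint l (i + 1)) * dirichletExtend v m
  map_add' v w := by
    funext i; simp only [dirichletExtend_add, Pi.add_apply]; ring
  map_smul' c v := by
    funext i; simp only [dirichletExtend_smul, Pi.smul_apply, smul_eq_mul, RingHom.id_apply]; ring

/-- `Λ 1, …, Λ l` is a list of all eigenvalues of the discrete problem, each repeated according
to its algebraic multiplicity. -/
def EnumeratesEigenvalues (q : ℝ → ℂ) (l m : ℕ) (Λ : ℕ → ℂ) : Prop :=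
  (frozenOperator q l m).charpoly.roots = (Finset.Icc 1 l).val.map Λ

/-- The eigenvalues `4 sin² (n h / 2) / h²` of the unperturbed discrete problem (`q = 0`). -/
noncomputable def freeEigenvalue (l n : ℕ) : ℝ :=
  4 * Real.sin ((n : ℝ) * meshSize l / 2) ^ 2 / meshSize l ^ 2

/-- The primed sum `Σ'_{j=0}^m a_j = a_0 / 2 + Σ_{j=1}^{m-1} a_j + a_m / 2`, for `m ≥ 1`. -/
noncomputable def primedSum (m : ℕ) (a : ℕ → ℂ) : ℂ :=
  a 0 / 2 + ∑ j ∈ Finset.Ioo 0 m, a j + a m / 2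

/-- The number `λ = (2 - 2 cos θ) / h²` with spectral angle `θ`. -/
noncomputable def angleToEigenvalue (l : ℕ) (θ : ℂ) : ℂ :=
  (2 - 2 * Complex.cos θ) / (meshSize l : ℂ) ^ 2

/-- The complex form of Jordan's inequality. -/
theorem two_div_pi_mul_norm_le_norm_sin {w : ℂ} (hw : |w.re| ≤ Real.pi / 2) :
    2 / Real.pi * ‖w‖ ≤ ‖Complex.sin w‖ := by
  have hpi := Real.pi_pos
  have hsin : 2 / Real.pi * |w.re| ≤ |Real.sin w.re| := by
    have h1 := Real.mul_le_sin (abs_nonneg w.re) hw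
    rcases abs_cases w.re with ⟨h, _⟩ | ⟨h, _⟩
    · rw [h] at h1 ⊢; exact h1.trans (le_abs_self _)
    · rw [h] at h1 ⊢; rw [Real.sin_neg] at h1; exact h1.trans (neg_le_abs _)
  have hsinh : |w.im| ≤ |Real.sinh w.im| := by
    rw [Real.abs_sinh]; exact Real.self_le_sinh_iff.2 (abs_nonneg _)
  have hn : ‖Complex.sin w‖ ^ 2 = Real.sin w.re ^ 2 + Real.sinh w.im ^ 2 := by
    have h2 := Complex.sin_eq w
    rw [← Complex.normSq_eq_norm_sq, Complex.normSq_apply, h2]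
    simp only [← Complex.ofReal_sin, ← Complex.ofReal_cos, ← Complex.ofReal_sinh,
      ← Complex.ofReal_cosh]
    simp only [Complex.add_re, Complex.mul_re, Complex.add_im, Complex.mul_im, Complex.ofReal_re,
      Complex.ofReal_im, Complex.I_re, Complex.I_im]
    have a := Real.cosh_sq w.im
    have b := Real.sin_sq_add_cos_sq w.re
    linear_combination Real.sin w.re ^ 2 * a + Real.sinh w.im ^ 2 * b
  have hw2 : ‖w‖ ^ 2 = w.re ^ 2 + w.im ^ 2 := by
    rw [← Complex.normSq_eq_norm_sq, Complex.normSq_apply]; ring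
  refine (sq_le_sq₀ (by positivity) (norm_nonneg _)).1 ?_
  rw [hn, mul_pow, hw2]
  have h1 : (2 / Real.pi) ^ 2 * w.re ^ 2 ≤ Real.sin w.re ^ 2 := by
    rw [← mul_pow]
    apply sq_le_sq.2
    rwa [abs_mul, abs_of_pos (by positivity : 0 < 2 / Real.pi)]
  have h2 : w.im ^ 2 ≤ Real.sinh w.im ^ 2 := sq_le_sq.2 hsinh
  have h3 : (2 / Real.pi) ^ 2 ≤ 1 := by
    apply pow_le_one₀ (by positivity)
    rw [div_le_one hpi]; linarith [Real.pi_gt_three]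
  nlinarith [sq_nonneg w.im]

theorem sq_norm_sub_le_norm_cos_sub_cos {θ : ℂ} {φ : ℝ} (hθ : θ.re ∈ Set.Icc 0 Real.pi)
    (hφ : φ ∈ Set.Icc 0 Real.pi) :
    2 / Real.pi ^ 2 * ‖θ - φ‖ ^ 2 ≤ ‖Complex.cos θ - Complex.cos φ‖ := by
  obtain ⟨hθ0, hθ1⟩ := hθ
  obtain ⟨hφ0, hφ1⟩ := hφ
  have hpi := Real.pi_pos
  have hminus : 1 / Real.pi * ‖θ - φ‖ ≤ ‖Complex.sin ((θ - φ) / 2)‖ := by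
    have hre : |((θ - φ) / 2).re| ≤ Real.pi / 2 := by
      simp; rw [abs_le]; constructor <;> linarith
    refine le_trans (le_of_eq ?_) (two_div_pi_mul_norm_le_norm_sin hre)
    rw [norm_div]; simp; field_simp
  have key : ∀ z : ℂ, |z.re| ≤ Real.pi / 2 → |θ.re - φ| ≤ |2 * z.re| → |θ.im| = |2 * z.im| →
      1 / Real.pi * ‖θ - φ‖ ≤ ‖Complex.sin z‖ := by
    intro z hz hre him
    refine le_trans ?_ (two_div_pi_mul_norm_le_norm_sin hz)
    have : ‖θ - φ‖ ≤ ‖2 * z‖ := by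
      refine (sq_le_sq₀ (by positivity) (norm_nonneg _)).1 ?_
      rw [← Complex.normSq_eq_norm_sq, ← Complex.normSq_eq_norm_sq, Complex.normSq_apply,
        Complex.normSq_apply]
      have h1 := sq_le_sq.2 hre
      have h2 := (sq_eq_sq_iff_abs_eq_abs _ _).2 him
      simp
      nlinarith
    rw [norm_mul] at this
    simp at this
    calc 1 / Real.pi * ‖θ - φ‖ ≤ 1 / Real.pi * (2 * ‖z‖) := by gcongr
      _ = _ := by ring
  have hplus : 1 / Real.pi * ‖θ - φ‖ ≤ ‖Complex.sin ((θ + φ) / 2)‖ := by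
    rcases le_total ((θ.re + φ) / 2) (Real.pi / 2) with h | h
    · apply key
      · simp; rw [abs_le]; constructor <;> linarith
      · simp [abs_div]
        rw [mul_div_cancel₀ _ two_ne_zero, abs_of_nonneg (by linarith : 0 ≤ θ.re + φ), abs_le]
        constructor <;> linarith
      · simp [abs_div]
        ring
    · rw [← Complex.sin_pi_sub]
      apply key
      · simp; rw [abs_le]; constructor <;> linarith
      · simp
        rw [abs_of_nonneg (by linarith : 0 ≤ Real.pi - (θ.re + φ) / 2), abs_le]
        constructor <;> linarith
      · simp [abs_div]
        ring
  rw [Complex.cos_sub_cos, norm_mul, norm_mul]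
  have : ‖(-2 : ℂ)‖ = 2 := by simp
  rw [this]
  calc 2 / Real.pi ^ 2 * ‖θ - φ‖ ^ 2 = 2 * (1 / Real.pi * ‖θ - φ‖) * (1 / Real.pi * ‖θ - φ‖) := by
        field_simp
    _ ≤ _ := by gcongr

theorem exists_cos_eq_of_re_mem_Icc (z : ℂ) :
    ∃ θ : ℂ, Complex.cos θ = z ∧ θ.re ∈ Set.Icc 0 Real.pi := by
  obtain ⟨θ, rfl⟩ := Complex.cos_surjective z
  have hpi := Real.pi_pos
  set k : ℤ := round (θ.re / (2 * Real.pi)) with hk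
  have hr := abs_sub_round (θ.re / (2 * Real.pi))
  rw [← hk] at hr
  have hb : |θ.re - k * (2 * Real.pi)| ≤ Real.pi := by
    have : θ.re - k * (2 * Real.pi) = (θ.re / (2 * Real.pi) - k) * (2 * Real.pi) := by
      field_simp
    rw [this, abs_mul, abs_of_pos (by positivity : 0 < 2 * Real.pi)]
    nlinarith
  have hc : Complex.cos (θ - k * (2 * Real.pi)) = Complex.cos θ := Complex.cos_sub_int_mul_two_pi θ k
  have hre : (θ - k * (2 * Real.pi)).re = θ.re - k * (2 * Real.pi) := by simp
  rw [abs_le] at hb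
  rcases le_total 0 (θ.re - k * (2 * Real.pi)) with h | h
  · exact ⟨_, hc, by rw [hre]; exact ⟨h, hb.2⟩⟩
  · refine ⟨-(θ - k * (2 * Real.pi)), by rw [Complex.cos_neg, hc], ?_⟩
    rw [Complex.neg_re, hre]
    constructor <;> linarith

theorem eq_of_cos_eq_of_re_mem_Ioo {θ φ : ℂ} (hθ : θ.re ∈ Set.Ioo 0 Real.pi)
    (hφ : φ.re ∈ Set.Ioo 0 Real.pi) (h : Complex.cos θ = Complex.cos φ) : θ = φ := by
  obtain ⟨k, hk⟩ := Complex.cos_eq_cos_iff.1 h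
  have hpi := Real.pi_pos
  have aux : ∀ x : ℝ, x = 2 * k * Real.pi → -2 * Real.pi < x → x < 2 * Real.pi → k = 0 := by
    intro x hx h1 h2
    have h3 : (-1 : ℝ) < k := by nlinarith
    have h4 : (k : ℝ) < 1 := by nlinarith
    have h5 : -1 < k := by exact_mod_cast h3
    have h6 : k < 1 := by exact_mod_cast h4
    omega
  rcases hk with hk | hk
  · have hr := congrArg Complex.re hk
    simp at hr
    have := aux (φ.re - θ.re) (by linarith) (by linarith [hθ.1, hθ.2, hφ.1, hφ.2])
      (by linarith [hθ.1, hθ.2, hφ.1, hφ.2])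
    subst this
    simpa using hk.symm
  · have hr := congrArg Complex.re hk
    simp at hr
    have := aux (φ.re + θ.re) (by linarith) (by linarith [hθ.1, hθ.2, hφ.1, hφ.2])
      (by linarith [hθ.1, hθ.2, hφ.1, hφ.2])
    subst this
    simp at hr
    linarith [hθ.1, hφ.1]

/-- The polynomial `∏ (X - μ k) * (1 - ∑ c k / (X - μ k))` of a rank-one perturbation of a diagonal
matrix. -/
noncomputable def secularPolynomial (s : Finset ℕ) (μ c : ℕ → ℂ) : Polynomial ℂ :=
  ∏ k ∈ s, (Polynomial.X - Polynomial.C (μ k)) -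
    ∑ k ∈ s, Polynomial.C (c k) * ∏ j ∈ s.erase k, (Polynomial.X - Polynomial.C (μ j))

/-- The partial fraction sum `∑ c k / (z - μ k)`. -/
noncomputable def secularSum (s : Finset ℕ) (μ c : ℕ → ℂ) (z : ℂ) : ℂ :=
  ∑ k ∈ s, c k / (z - μ k)

theorem eval_secularPolynomial {s : Finset ℕ} {μ c : ℕ → ℂ} {z : ℂ} (hz : ∀ k ∈ s, z ≠ μ k) :
    (secularPolynomial s μ c).eval z = (∏ k ∈ s, (z - μ k)) * (1 - secularSum s μ c z) := by
  simp only [secularPolynomial, secularSum, Polynomial.eval_sub, Polynomial.eval_prod,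
    Polynomial.eval_finsetSum, Polynomial.eval_mul, Polynomial.eval_X, Polynomial.eval_C]
  rw [mul_sub, mul_one, Finset.mul_sum]
  congr 1
  refine Finset.sum_congr rfl fun k hk => ?_
  rw [← Finset.mul_prod_erase s _ hk]
  have := sub_ne_zero.2 (hz k hk)
  field_simp

theorem eval_secularPolynomial_of_mem {s : Finset ℕ} {μ c : ℕ → ℂ} {z : ℂ} {n : ℕ} (hn : n ∈ s)
    (hz : ∀ k ∈ s.erase n, z ≠ μ k) :
    (secularPolynomial s μ c).eval z = (∏ k ∈ s.erase n, (z - μ k)) *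
      ((z - μ n) * (1 - secularSum (s.erase n) μ c z) - c n) := by
  simp only [secularPolynomial, secularSum, Polynomial.eval_sub, Polynomial.eval_prod,
    Polynomial.eval_finsetSum, Polynomial.eval_mul, Polynomial.eval_X, Polynomial.eval_C]
  rw [← Finset.mul_prod_erase s _ hn, ← Finset.add_sum_erase s _ hn]
  have : ∑ k ∈ s.erase n, c k * ∏ j ∈ s.erase k, (z - μ j) =
      (z - μ n) * (∏ k ∈ s.erase n, (z - μ k)) * ∑ k ∈ s.erase n, c k / (z - μ k) := by
    rw [Finset.mul_sum]
    refine Finset.sum_congr rfl fun k hk => ?_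
    have hne := (Finset.mem_erase.1 hk).1
    have h1 : n ∈ s.erase k := Finset.mem_erase.2 ⟨hne.symm, hn⟩
    rw [← Finset.mul_prod_erase (s.erase n) _ hk, ← Finset.mul_prod_erase (s.erase k) _ h1,
      Finset.erase_right_comm]
    have := sub_ne_zero.2 (hz k hk)
    field_simp
  rw [this]
  ring

theorem isRoot_secularPolynomial_iff {s : Finset ℕ} {μ c : ℕ → ℂ} {z : ℂ} {n : ℕ} (hn : n ∈ s)
    (hz : ∀ k ∈ s.erase n, z ≠ μ k) :
    (secularPolynomial s μ c).IsRoot z ↔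
      z = μ n + c n + (z - μ n) * secularSum (s.erase n) μ c z := by
  rw [Polynomial.IsRoot.def, eval_secularPolynomial_of_mem hn hz, mul_eq_zero,
    or_iff_right (Finset.prod_ne_zero_iff.2 fun k hk => sub_ne_zero.2 (hz k hk))]
  constructor <;> intro h <;> linear_combination h

theorem norm_secularSum_le (s : Finset ℕ) (μ c : ℕ → ℂ) (z : ℂ) :
    ‖secularSum s μ c z‖ ≤ ∑ k ∈ s, ‖c k‖ / ‖z - μ k‖ :=
  (norm_sum_le _ _).trans_eq (by simp)

theorem norm_secularSum_sub_le {s : Finset ℕ} {μ c : ℕ → ℂ} {z w : ℂ} {b : ℝ} (hb : 0 < b)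
    (hz : ∀ k ∈ s, b ≤ ‖z - μ k‖) (hw : ∀ k ∈ s, b ≤ ‖w - μ k‖) :
    ‖secularSum s μ c z - secularSum s μ c w‖ ≤
      ‖z - w‖ * ((∑ k ∈ s, ‖c k‖ / ‖z - μ k‖) / b) := by
  rw [secularSum, secularSum, ← Finset.sum_sub_distrib, Finset.sum_div, Finset.mul_sum]
  refine norm_sum_le_of_le _ fun k hk => ?_
  have h1 : 0 < ‖z - μ k‖ := hb.trans_le (hz k hk)
  have h2 : 0 < ‖w - μ k‖ := hb.trans_le (hw k hk)
  have h3 : c k / (z - μ k) - c k / (w - μ k) = (w - z) * (c k / (z - μ k) / (w - μ k)) := by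
    have := norm_pos_iff.1 h1
    have := norm_pos_iff.1 h2
    field_simp
    ring
  rw [h3, norm_mul, norm_div, norm_div, norm_sub_rev w z]
  gcongr
  exact hw k hk

theorem norm_sub_le_of_isRoot_secularPolynomial {s : Finset ℕ} {μ c : ℕ → ℂ} {z : ℂ} {n : ℕ}
    (hn : n ∈ s) (hz : ∀ k ∈ s.erase n, z ≠ μ k)
    (hsum : ∑ k ∈ s.erase n, ‖c k‖ / ‖z - μ k‖ ≤ 1 / 2)
    (h : (secularPolynomial s μ c).IsRoot z) :
    ‖z - μ n‖ ≤ 2 * ‖c n‖ ∧ ‖z - (μ n + c n)‖ ≤ ‖c n‖ := by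
  rw [isRoot_secularPolynomial_iff hn hz] at h
  have hS := (norm_secularSum_le (s.erase n) μ c z).trans hsum
  set S := secularSum (s.erase n) μ c z
  have h1 : ‖z - (μ n + c n)‖ ≤ ‖z - μ n‖ * (1 / 2) := by
    have : z - (μ n + c n) = (z - μ n) * S := by linear_combination h
    rw [this, norm_mul]
    gcongr
  have h2 : ‖z - μ n‖ ≤ ‖z - (μ n + c n)‖ + ‖c n‖ := by
    have : z - μ n = (z - (μ n + c n)) + c n := by ring
    rw [this]
    exact norm_add_le _ _
  constructor <;> linarith

/-- A root of the secular polynomial close to `μ n`, when the other coefficients are small. -/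
theorem exists_simple_root_secularPolynomial {s : Finset ℕ} {μ c : ℕ → ℂ} {n : ℕ} {r b ε : ℝ}
    (hn : n ∈ s) (hr : 0 < r) (hb : 0 < b)
    (hsep : ∀ z ∈ Metric.closedBall (μ n) r, ∀ k ∈ s.erase n, b ≤ ‖z - μ k‖)
    (hsum : ∀ z ∈ Metric.closedBall (μ n) r, ∑ k ∈ s.erase n, ‖c k‖ / ‖z - μ k‖ ≤ ε)
    (hε : (1 + r / b) * ε ≤ 1 / 2) (hcn : ‖c n‖ ≤ r / 4) :
    ∃ z, ‖z - μ n‖ ≤ 2 * ‖c n‖ ∧ ‖z - (μ n + c n)‖ ≤ ‖c n‖ ∧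
      (secularPolynomial s μ c).rootMultiplicity z = 1 ∧
      ∀ w ∈ Metric.closedBall (μ n) r, (secularPolynomial s μ c).IsRoot w → w = z := by
  set P := secularPolynomial s μ c with hP
  set B := Metric.closedBall (μ n) r with hB
  have hmem : μ n ∈ B := Metric.mem_closedBall_self hr.le
  have hε0 : 0 ≤ ε := le_trans (Finset.sum_nonneg fun k _ => by positivity) (hsum _ hmem)
  have hε2 : ε ≤ 1 / 2 := by
    have : 0 ≤ r / b * ε := by positivity
    linarith
  have hne : ∀ z ∈ B, ∀ k ∈ s.erase n, z ≠ μ k := fun z hz k hk h => by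
    have := hsep z hz k hk
    rw [h, sub_self, norm_zero] at this
    linarith
  set G : ℂ → ℂ := fun z => μ n + c n + (z - μ n) * secularSum (s.erase n) μ c z with hG
  have hlip : ∀ z ∈ B, ∀ w ∈ B, ‖G z - G w‖ ≤ 1 / 2 * ‖z - w‖ := by
    intro z hz w hw
    have h1 : G z - G w = (z - w) * secularSum (s.erase n) μ c w +
        (z - μ n) * (secularSum (s.erase n) μ c z - secularSum (s.erase n) μ c w) := by
      simp only [hG]; ring
    have h2 := (norm_secularSum_le (s.erase n) μ c w).trans (hsum w hw)
    have h3 := norm_secularSum_sub_le (c := c) hb (hsep z hz) (hsep w hw)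
    have h4 : ‖z - μ n‖ ≤ r := by simpa [hB, dist_eq_norm] using hz
    calc ‖G z - G w‖ ≤ ‖z - w‖ * ε + r * (‖z - w‖ * (ε / b)) := by
          rw [h1]
          refine norm_add_le_of_le ?_ ?_ <;> rw [norm_mul]
          · gcongr
          · refine mul_le_mul h4 (h3.trans ?_) (norm_nonneg _) hr.le
            gcongr
            exact hsum z hz
      _ = (1 + r / b) * ε * ‖z - w‖ := by ring
      _ ≤ _ := by gcongr
  have hmaps : Set.MapsTo G B B := by
    intro z hz
    have h1 := hlip z hz _ hmem
    have h4 : ‖z - μ n‖ ≤ r := by simpa [hB, dist_eq_norm] using hz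
    have h2 : G (μ n) = μ n + c n := by simp [hG]
    rw [h2] at h1
    have h3 : ‖G z - μ n‖ ≤ ‖G z - (μ n + c n)‖ + ‖c n‖ := by
      have : G z - μ n = (G z - (μ n + c n)) + c n := by ring
      rw [this]
      exact norm_add_le _ _
    rw [hB, Metric.mem_closedBall, dist_eq_norm]
    linarith
  have hcontr : ContractingWith (1 / 2) (hmaps.restrict G B B) := by
    refine ⟨by rw [← NNReal.coe_lt_coe]; norm_num, LipschitzWith.of_dist_le_mul fun x y => ?_⟩
    have := hlip x x.2 y y.2
    simpa [Subtype.dist_eq, dist_eq_norm] using this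
  obtain ⟨z, hzB, hfix, -⟩ := hcontr.exists_fixedPoint' Metric.isClosed_closedBall.isComplete hmaps
    hmem (edist_ne_top _ _)
  have hfix' : G z = z := hfix
  have hroot : ∀ w ∈ B, P.IsRoot w ↔ w = G w := fun w hw =>
    isRoot_secularPolynomial_iff hn (hne w hw)
  have hzroot : P.IsRoot z := (hroot z hzB).2 hfix'.symm
  obtain ⟨hzn, hzc⟩ := norm_sub_le_of_isRoot_secularPolynomial hn (hne z hzB)
    ((hsum z hzB).trans hε2) hzroot
  have hlower : ∀ w ∈ B, ‖∏ k ∈ s.erase n, (w - μ k)‖ * (‖w - z‖ / 2) ≤ ‖P.eval w‖ := by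
    intro w hw
    rw [hP, eval_secularPolynomial_of_mem hn (hne w hw), norm_mul]
    gcongr
    have h1 : (w - μ n) * (1 - secularSum (s.erase n) μ c w) - c n = (w - z) - (G w - G z) := by
      rw [hfix']
      simp only [hG]; ring
    rw [h1]
    have := norm_sub_norm_le (w - z) (G w - G z)
    have := hlip w hw z hzB
    linarith
  have hQ : ∀ w ∈ B, 0 < ‖∏ k ∈ s.erase n, (w - μ k)‖ := fun w hw =>
    norm_pos_iff.2 (Finset.prod_ne_zero_iff.2 fun k hk => sub_ne_zero.2 (hne w hw k hk))
  have hnhds : B ∈ nhds z := by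
    refine Filter.mem_of_superset (Metric.ball_mem_nhds z (half_pos hr)) fun w hw => ?_
    rw [Metric.mem_ball, dist_eq_norm] at hw
    rw [hB, Metric.mem_closedBall, dist_eq_norm]
    have : w - μ n = (w - z) + (z - μ n) := by ring
    rw [this]
    exact (norm_add_le _ _).trans (by linarith)
  refine ⟨z, hzn, hzc, ?_, fun w hw hwr => ?_⟩
  · have hP0 : P ≠ 0 := by
      intro h0
      obtain ⟨w, hw, hwz⟩ : ∃ w ∈ B, w ≠ z := by
        have h1 : μ n + (r : ℂ) ∈ B := by
          simp [hB, dist_eq_norm, abs_of_pos hr]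
        by_cases h : μ n = z
        · exact ⟨_, h1, by rw [← h]; simpa using hr.ne'⟩
        · exact ⟨_, hmem, h⟩
      have := hlower w hw
      rw [h0, Polynomial.eval_zero, norm_zero] at this
      have h2 := mul_pos (hQ w hw) (half_pos (norm_pos_iff.2 (sub_ne_zero.2 hwz)))
      linarith
    have h1 : 0 < P.rootMultiplicity z := (Polynomial.rootMultiplicity_pos hP0).2 hzroot
    by_contra hne1
    have h2 : 2 ≤ P.rootMultiplicity z := by omega
    obtain ⟨W, hW⟩ := (Polynomial.le_rootMultiplicity_iff hP0).1 h2
    have hev : ∀ᶠ w in nhdsWithin z {z}ᶜ,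
        ‖∏ k ∈ s.erase n, (w - μ k)‖ ≤ 2 * ‖w - z‖ * ‖W.eval w‖ := by
      filter_upwards [mem_nhdsWithin_of_mem_nhds hnhds, self_mem_nhdsWithin] with w hw hwz
      have h3 := hlower w hw
      rw [hW] at h3
      simp only [Polynomial.eval_mul, Polynomial.eval_pow, Polynomial.eval_sub, Polynomial.eval_X,
        Polynomial.eval_C, norm_mul, norm_pow] at h3
      have h4 : 0 < ‖w - z‖ := norm_pos_iff.2 (sub_ne_zero.2 hwz)
      nlinarith
    have hl : Filter.Tendsto (fun w : ℂ => ‖∏ k ∈ s.erase n, (w - μ k)‖) (nhdsWithin z {z}ᶜ)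
        (nhds ‖∏ k ∈ s.erase n, (z - μ k)‖) :=
      (Continuous.tendsto (by fun_prop) z).mono_left nhdsWithin_le_nhds
    have hr' : Filter.Tendsto (fun w : ℂ => 2 * ‖w - z‖ * ‖W.eval w‖) (nhdsWithin z {z}ᶜ)
        (nhds (2 * ‖z - z‖ * ‖W.eval z‖)) :=
      (Continuous.tendsto (f := fun w : ℂ => 2 * ‖w - z‖ * ‖W.eval w‖)
        (by fun_prop) z).mono_left nhdsWithin_le_nhds
    have := le_of_tendsto_of_tendsto hl hr' hev
    simp only [sub_self, norm_zero, mul_zero, zero_mul] at this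
    exact absurd this (not_le.2 (hQ z hzB))
  · have h1 := hlip w hw z hzB
    rw [← (hroot w hw).1 hwr, hfix'] at h1
    have h2 : ‖w - z‖ ≤ 0 := by linarith [norm_nonneg (w - z)]
    exact sub_eq_zero.1 (norm_le_zero_iff.1 h2)

/-- The sum of `1 / z ^ 2` over the integers. -/
noncomputable def intInvSqSum : ℝ := ∑' z : ℤ, 1 / (z : ℝ) ^ 2

theorem sum_one_div_sub_sq_le (s : Finset ℕ) (n : ℕ) :
    ∑ k ∈ s, 1 / ((k : ℝ) - n) ^ 2 ≤ intInvSqSum := by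
  have hsum : Summable fun z : ℤ => 1 / (z : ℝ) ^ 2 := Real.summable_one_div_int_pow.2 one_lt_two
  have hinj : Function.Injective fun k : ℕ => (k : ℤ) - n := fun a b h => by
    simp only at h; omega
  have := hsum.sum_le_tsum (s.map ⟨_, hinj⟩) (fun _ _ => by positivity)
  simpa [intInvSqSum, Finset.sum_map] using this

theorem sum_one_div_mul_sub_sq_le {s : Finset ℕ} {n : ℕ} (hs : ∀ k ∈ s, 1 ≤ k) (hn : 1 ≤ n) :
    ∑ k ∈ s.erase n, 1 / ((k : ℝ) * ((k : ℝ) - n) ^ 2) ≤ 2 * intInvSqSum / n := by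
  have hn0 : (0 : ℝ) < n := by exact_mod_cast hn
  have hterm : ∀ k ∈ s.erase n, 1 / ((k : ℝ) * ((k : ℝ) - n) ^ 2) ≤
      (3 / 2 * (1 / ((k : ℝ) - n) ^ 2) + 1 / 2 * (1 / ((k : ℝ) - (0 : ℕ)) ^ 2)) / n := by
    intro k hk
    obtain ⟨hkn, hks⟩ := Finset.mem_erase.1 hk
    have hk0 : (0 : ℝ) < k := by exact_mod_cast hs k hks
    have hd : (k : ℝ) - n ≠ 0 := sub_ne_zero.2 (by exact_mod_cast hkn)
    rw [le_div_iff₀ hn0, Nat.cast_zero, sub_zero]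
    have : 1 / ((k : ℝ) * ((k : ℝ) - n) ^ 2) * n =
        1 / ((k : ℝ) - n) ^ 2 - (1 / (k : ℝ)) * (1 / ((k : ℝ) - n)) := by
      field_simp
      ring
    rw [this]
    have h1 : 1 / ((k : ℝ) - n) ^ 2 = (1 / ((k : ℝ) - n)) ^ 2 := by simp
    have h2 : 1 / (k : ℝ) ^ 2 = (1 / (k : ℝ)) ^ 2 := by simp
    rw [h1, h2]
    nlinarith [sq_nonneg (1 / (k : ℝ) + 1 / ((k : ℝ) - n))]
  refine (Finset.sum_le_sum hterm).trans ?_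
  rw [← Finset.sum_div, Finset.sum_add_distrib, ← Finset.mul_sum, ← Finset.mul_sum]
  gcongr
  have h1 := sum_one_div_sub_sq_le (s.erase n) n
  have h2 := sum_one_div_sub_sq_le (s.erase n) 0
  linarith

theorem sum_norm_div_norm_sub_le {s : Finset ℕ} {μ c : ℕ → ℂ} {n : ℕ} {z : ℂ} {K b : ℝ}
    (hs : ∀ k ∈ s, 1 ≤ k) (hn : 1 ≤ n) (hb : 0 < b) (hK : 0 ≤ K) (hc : ∀ k ∈ s, ‖c k‖ ≤ K / k)
    (hz : ∀ k ∈ s.erase n, b * ((k : ℝ) - n) ^ 2 ≤ ‖z - μ k‖) :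
    ∑ k ∈ s.erase n, ‖c k‖ / ‖z - μ k‖ ≤ 2 * intInvSqSum * K / b / n := by
  calc ∑ k ∈ s.erase n, ‖c k‖ / ‖z - μ k‖
      ≤ ∑ k ∈ s.erase n, K / b * (1 / ((k : ℝ) * ((k : ℝ) - n) ^ 2)) := by
        refine Finset.sum_le_sum fun k hk => ?_
        obtain ⟨hkn, hks⟩ := Finset.mem_erase.1 hk
        have hd : (k : ℝ) - n ≠ 0 := sub_ne_zero.2 (by exact_mod_cast hkn)
        have hk0 : (0 : ℝ) < k := by exact_mod_cast hs k hks
        calc ‖c k‖ / ‖z - μ k‖ ≤ K / k / (b * ((k : ℝ) - n) ^ 2) := by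
              gcongr
              · exact hc k hks
              · exact hz k hk
          _ = _ := by field_simp
    _ ≤ K / b * (2 * intInvSqSum / n) := by
        rw [← Finset.mul_sum]
        gcongr
        exact sum_one_div_mul_sub_sq_le hs hn
    _ = _ := by ring

theorem two_mul_sin_half_mul_sum_cos (N : ℕ) (y : ℝ) :
    2 * Real.sin (y / 2) * ∑ j ∈ Finset.range N, Real.cos (j * y) =
      Real.sin (N * y - y / 2) + Real.sin (y / 2) := by
  induction N with
  | zero => simp
  | succ N ih =>
    rw [Finset.sum_range_succ, mul_add, ih]
    have h1 : ((N + 1 : ℕ) : ℝ) * y - y / 2 = N * y + y / 2 := by push_cast; ring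
    rw [h1, Real.sin_sub, Real.sin_add]
    ring

theorem sum_cos_mul_pi_div {N r : ℕ} (hr : 0 < r) (hrN : r < 2 * N) :
    ∑ j ∈ Finset.range N, Real.cos (j * (r * (Real.pi / N))) = (1 - (-1) ^ r) / 2 := by
  have hN : (0 : ℝ) < N := by exact_mod_cast (by omega : 0 < N)
  have hpi := Real.pi_pos
  have hr0 : (0 : ℝ) < r := by exact_mod_cast hr
  have hrN' : (r : ℝ) < 2 * N := by exact_mod_cast hrN
  have h := two_mul_sin_half_mul_sum_cos N (r * (Real.pi / N))
  have h1 : (N : ℝ) * (r * (Real.pi / N)) = r * Real.pi := by field_simp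
  rw [h1, Real.sin_nat_mul_pi_sub] at h
  have hs : 0 < Real.sin (r * (Real.pi / N) / 2) := by
    apply Real.sin_pos_of_pos_of_lt_pi (by positivity)
    rw [← mul_div_assoc, div_div, div_lt_iff₀ (by positivity)]
    nlinarith
  have h2 : 2 * Real.sin (r * (Real.pi / N) / 2) ≠ 0 := by positivity
  apply mul_left_cancel₀ h2
  rw [h]
  ring

theorem sum_sin_mul_sin {N n k : ℕ} (hn : 0 < n) (hnN : n < N) (hk : 0 < k) (hkN : k < N) :
    ∑ j ∈ Finset.range N, Real.sin (j * (n * (Real.pi / N))) * Real.sin (j * (k * (Real.pi / N))) =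
      if n = k then (N : ℝ) / 2 else 0 := by
  wlog hle : k ≤ n generalizing n k
  · rw [Finset.sum_congr rfl fun j _ => mul_comm _ _, this hk hkN hn hnN (by omega)]
    simp only [eq_comm]
  have hprod : ∀ j : ℕ, Real.sin (j * (n * (Real.pi / N))) * Real.sin (j * (k * (Real.pi / N))) =
      (Real.cos (j * ((n - k : ℕ) * (Real.pi / N))) -
        Real.cos (j * ((n + k : ℕ) * (Real.pi / N)))) / 2 := by
    intro j
    have h1 : (j : ℝ) * ((n - k : ℕ) * (Real.pi / N)) =
        j * (n * (Real.pi / N)) - j * (k * (Real.pi / N)) := by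
      rw [Nat.cast_sub hle]; ring
    have h2 : (j : ℝ) * ((n + k : ℕ) * (Real.pi / N)) =
        j * (n * (Real.pi / N)) + j * (k * (Real.pi / N)) := by
      push_cast; ring
    rw [h1, h2, Real.cos_sub, Real.cos_add]
    ring
  simp only [hprod]
  rw [← Finset.sum_div, Finset.sum_sub_distrib, sum_cos_mul_pi_div (r := n + k) (by omega) (by omega)]
  split_ifs with h
  · subst h
    simp [← two_mul]
  · rw [sum_cos_mul_pi_div (r := n - k) (by omega) (by omega)]
    have : (-1 : ℝ) ^ (n + k) = (-1) ^ (n - k) := by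
      have : n + k = (n - k) + 2 * k := by omega
      rw [this, pow_add, pow_mul]
      simp
    rw [this]
    ring

@[to_additive]
theorem prod_fin_succ_eq_prod_Icc {M : Type*} [CommMonoid M] (l : ℕ) (f : ℕ → M) :
    ∏ i : Fin l, f (i + 1) = ∏ k ∈ Finset.Icc 1 l, f k := by
  rw [Fin.prod_univ_eq_prod_range (fun i => f (i + 1)) l, Finset.range_eq_Ico,
    Finset.prod_Ico_add' f 0 l 1]
  rfl

/-- The sine matrix `sin (j k h)`, `1 ≤ j, k ≤ l`. -/
noncomputable def sineMatrix (l : ℕ) : Matrix (Fin l) (Fin l) ℂ :=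
  Matrix.of fun i k => ((Real.sin (((i + 1 : ℕ) : ℝ) * gridPoint l (k + 1)) : ℝ) : ℂ)

theorem sineMatrix_mul_self (l : ℕ) :
    sineMatrix l * sineMatrix l = (((l : ℂ) + 1) / 2) • (1 : Matrix (Fin l) (Fin l) ℂ) := by
  ext i k
  rw [Matrix.mul_apply, Matrix.smul_apply, Matrix.one_apply]
  have h := sum_sin_mul_sin (N := l + 1) (n := i + 1) (k := k + 1) (by omega) (by omega)
    (by omega) (by omega)
  rw [Finset.sum_range_succ', ← Fin.sum_univ_eq_sum_range
    (fun j => Real.sin ((j + 1 : ℕ) * ((i + 1 : ℕ) * (Real.pi / (l + 1 : ℕ)))) *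
      Real.sin ((j + 1 : ℕ) * ((k + 1 : ℕ) * (Real.pi / (l + 1 : ℕ))))) l] at h
  simp only [Nat.cast_zero, zero_mul, Real.sin_zero, mul_zero, add_zero] at h
  have h' := congrArg (fun x : ℝ => (x : ℂ)) h
  simp only [Complex.ofReal_sum, Complex.ofReal_mul] at h'
  calc _ = _ := by
        refine Finset.sum_congr rfl fun j _ => ?_
        simp only [sineMatrix, Matrix.of_apply, gridPoint, meshSize]
        congr 3 <;> push_cast <;> ring
    _ = _ := h'
    _ = _ := by
        by_cases hik : i = k
        · subst hik; simp
        · have : ¬ ((i : ℕ) + 1 = k + 1) := fun h => hik (Fin.ext (by omega))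
          rw [if_neg this, if_neg hik]
          simp

/-- The coefficients of the rank-one perturbation in the sine basis. -/
noncomputable def frozenCoeff (q : ℝ → ℂ) (l m k : ℕ) : ℂ :=
  2 / ((l : ℂ) + 1) * (∑ j ∈ Finset.Icc 1 l, q (gridPoint l j) * (Real.sin (k * gridPoint l j) : ℂ)) *
    (Real.sin (k * gridPoint l m) : ℂ)

theorem meshSize_pos (l : ℕ) : 0 < meshSize l := by
  unfold meshSize
  have := Real.pi_pos
  positivity

theorem freeEigenvalue_eq (l n : ℕ) :
    freeEigenvalue l n = (2 - 2 * Real.cos (n * meshSize l)) / meshSize l ^ 2 := by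
  have h : (n : ℝ) * meshSize l = 2 * (n * meshSize l / 2) := by ring
  rw [freeEigenvalue]
  rw [(congrArg Real.cos h).trans (Real.cos_two_mul' _)]
  congr 1
  linear_combination 2 * Real.sin_sq_add_cos_sq (n * meshSize l / 2)

theorem dirichletExtend_sin (l k j : ℕ) (hj : j ≤ l + 1) :
    dirichletExtend (fun i : Fin l => ((Real.sin (((i + 1 : ℕ) : ℝ) * gridPoint l k) : ℝ) : ℂ)) j =
      (Real.sin (j * gridPoint l k) : ℂ) := by
  unfold dirichletExtend
  split_ifs with h
  · simp only
    rw [Nat.sub_add_cancel h.1]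
  · obtain rfl | rfl : j = 0 ∨ j = l + 1 := by omega
    · simp
    · have : ((l + 1 : ℕ) : ℝ) * gridPoint l k = k * Real.pi := by
        unfold gridPoint meshSize
        have : (l : ℝ) + 1 ≠ 0 := by positivity
        push_cast
        field_simp
      rw [this, Real.sin_nat_mul_pi, Complex.ofReal_zero]

theorem frozenOperator_sin (q : ℝ → ℂ) (l m k : ℕ) (hm : m ≤ l + 1) (i : Fin l) :
    frozenOperator q l m
        (fun i : Fin l => ((Real.sin (((i + 1 : ℕ) : ℝ) * gridPoint l k) : ℝ) : ℂ)) i =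
      (freeEigenvalue l k : ℂ) * (Real.sin (((i + 1 : ℕ) : ℝ) * gridPoint l k) : ℂ) +
        q (gridPoint l (i + 1)) * (Real.sin (m * gridPoint l k) : ℂ) := by
  change -(dirichletExtend _ _ - 2 * dirichletExtend _ _ + dirichletExtend _ _) / _ + _ *
    dirichletExtend _ _ = _
  rw [dirichletExtend_sin _ _ _ (by omega), dirichletExtend_sin _ _ _ (by omega),
    dirichletExtend_sin _ _ _ (by omega), dirichletExtend_sin _ _ _ hm]
  congr 1
  rw [freeEigenvalue_eq]
  norm_cast
  have h2 : ((i + 2 : ℕ) : ℝ) * gridPoint l k = ((i + 1 : ℕ) : ℝ) * gridPoint l k + k * meshSize l := by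
    unfold gridPoint; push_cast; ring
  have h0 : ((i : ℕ) : ℝ) * gridPoint l k = ((i + 1 : ℕ) : ℝ) * gridPoint l k - k * meshSize l := by
    unfold gridPoint; push_cast; ring
  rw [h2, h0, Real.sin_add, Real.sin_sub]
  ring

theorem det_diagonal_sub_vecMulVec {n : Type*} [Fintype n] [DecidableEq n] {d : n → ℂ}
    (hd : ∀ i, d i ≠ 0) (u v : n → ℂ) :
    (Matrix.diagonal d - Matrix.vecMulVec u v).det = (∏ i, d i) * (1 - ∑ i, u i * v i / d i) := by
  have h : Matrix.diagonal d - Matrix.vecMulVec u v = Matrix.diagonal d *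
      (1 + Matrix.replicateCol Unit (fun i => -(u i / d i)) * Matrix.replicateRow Unit v) := by
    ext i j
    rw [Matrix.diagonal_mul, Matrix.sub_apply, Matrix.add_apply, Matrix.mul_apply]
    have := hd i
    by_cases hij : i = j
    · subst hij
      simp [Matrix.vecMulVec_apply]
      field_simp
      ring
    · simp [Matrix.vecMulVec_apply, hij]
      field_simp
  rw [h, Matrix.det_mul, Matrix.det_diagonal, Matrix.det_one_add_replicateCol_mul_replicateRow]
  congr 1
  simp only [dotProduct, sub_eq_add_neg, ← Finset.sum_neg_distrib]
  congr 1
  refine Finset.sum_congr rfl fun i _ => ?_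
  ring

theorem charpoly_frozenOperator (q : ℝ → ℂ) {l m : ℕ} (hm : m ≤ l + 1) :
    (frozenOperator q l m).charpoly =
      secularPolynomial (Finset.Icc 1 l) (fun k => (freeEigenvalue l k : ℂ)) (frozenCoeff q l m) := by
  have hl : (l : ℂ) + 1 ≠ 0 := by exact_mod_cast l.succ_ne_zero
  set S := sineMatrix l with hS
  set Q : Fin l → ℂ := fun j => q (gridPoint l (j + 1)) with hQ
  set u : Fin l → ℂ := (2 / ((l : ℂ) + 1)) • S.mulVec Q with hu
  set v : Fin l → ℂ := fun k => (Real.sin (m * gridPoint l (k + 1)) : ℂ) with hv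
  set d : Fin l → ℂ := fun k => (freeEigenvalue l (k + 1) : ℂ) with hd
  set A := LinearMap.toMatrix' (frozenOperator q l m) with hA
  have hSS : S * S = (((l : ℂ) + 1) / 2) • 1 := sineMatrix_mul_self l
  have hinv : S * ((2 / ((l : ℂ) + 1)) • S) = 1 := by
    rw [Matrix.mul_smul, hSS, smul_smul]
    have : 2 / ((l : ℂ) + 1) * (((l : ℂ) + 1) / 2) = 1 := by field_simp
    rw [this, one_smul]
  have hinv' : ((2 / ((l : ℂ) + 1)) • S) * S = 1 := by
    rw [Matrix.smul_mul, ← Matrix.mul_smul, hinv]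
  have hSu : S.mulVec u = Q := by
    rw [hu, Matrix.mulVec_smul, ← Matrix.smul_mulVec, Matrix.mulVec_mulVec, hinv',
      Matrix.one_mulVec]
  have hAS : A * S = S * (Matrix.diagonal d + Matrix.vecMulVec u v) := by
    rw [mul_add, Matrix.mul_vecMulVec, hSu]
    ext i k
    have h1 : (A * S) i k = (A.mulVec (fun j => S j k)) i := rfl
    rw [h1, hA, LinearMap.toMatrix'_mulVec, Matrix.add_apply, Matrix.mul_diagonal,
      Matrix.vecMulVec_apply]
    simp only [hS, sineMatrix, Matrix.of_apply]
    rw [frozenOperator_sin q l m _ hm]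
    simp only [hd, hQ, hv]
    ring
  set U : (Matrix (Fin l) (Fin l) ℂ)ˣ := ⟨S, (2 / ((l : ℂ) + 1)) • S, hinv, hinv'⟩ with hU
  have hconj : A = U.val * (Matrix.diagonal d + Matrix.vecMulVec u v) * U⁻¹.val := by
    rw [← hAS, Matrix.mul_assoc]
    exact (by rw [hinv, Matrix.mul_one] : A * (S * ((2 / ((l : ℂ) + 1)) • S)) = A).symm
  have hchar : (frozenOperator q l m).charpoly =
      (Matrix.diagonal d + Matrix.vecMulVec u v).charpoly := by
    rw [← Matrix.charpoly_units_conj U, ← Matrix.coe_units_inv, ← hconj, hA,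
      ← LinearMap.toMatrix_eq_toMatrix', LinearMap.charpoly_toMatrix]
  rw [hchar]
  apply Polynomial.eq_of_infinite_eval_eq
  refine (Set.Finite.infinite_compl (s := (Finset.Icc 1 l).image
    (fun k => (freeEigenvalue l k : ℂ))) (Finset.finite_toSet _)).mono fun z hz => ?_
  have hz' : ∀ k ∈ Finset.Icc 1 l, z ≠ (freeEigenvalue l k : ℂ) := fun k hk h =>
    hz (by rw [Finset.mem_coe, Finset.mem_image]; exact ⟨k, hk, h.symm⟩)
  rw [Set.mem_ofPred_eq, Matrix.eval_charpoly, eval_secularPolynomial hz']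
  have h1 : Matrix.scalar (Fin l) z - (Matrix.diagonal d + Matrix.vecMulVec u v) =
      Matrix.diagonal (fun i => z - d i) - Matrix.vecMulVec u v := by
    rw [Matrix.scalar_apply, ← Matrix.diagonal_sub]
    abel
  rw [h1, det_diagonal_sub_vecMulVec fun i => sub_ne_zero.2 (hz' _ (by simp))]
  rw [prod_fin_succ_eq_prod_Icc l (fun k => z - (freeEigenvalue l k : ℂ)), secularSum,
    ← sum_fin_succ_eq_sum_Icc]
  congr 2
  refine Finset.sum_congr rfl fun k _ => ?_
  congr 1
  rw [frozenCoeff, ← sum_fin_succ_eq_sum_Icc]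
  simp only [hu, hv, Pi.smul_apply, smul_eq_mul, Matrix.mulVec, dotProduct, hS, sineMatrix, hQ,
    Matrix.of_apply]
  have h2 : (m : ℝ) * gridPoint l (k + 1) = ((k + 1 : ℕ) : ℝ) * gridPoint l m := by
    unfold gridPoint; ring
  rw [h2]
  congr 2
  refine Finset.sum_congr rfl fun j _ => ?_
  rw [mul_comm]

theorem secularPolynomial_filter {s : Finset ℕ} {μ c : ℕ → ℂ} (p : ℕ → Prop) [DecidablePred p]
    (hc : ∀ k ∈ s, ¬ p k → c k = 0) :
    secularPolynomial s μ c = secularPolynomial (s.filter p) μ c *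
      ∏ k ∈ s.filter (fun k => ¬ p k), (Polynomial.X - Polynomial.C (μ k)) := by
  apply Polynomial.eq_of_infinite_eval_eq
  refine (Set.Finite.infinite_compl (s := s.image μ) (Finset.finite_toSet _)).mono fun z hz => ?_
  have hz' : ∀ k ∈ s, z ≠ μ k := fun k hk h =>
    hz (by rw [Finset.mem_coe, Finset.mem_image]; exact ⟨k, hk, h.symm⟩)
  rw [Set.mem_ofPred_eq, Polynomial.eval_mul, eval_secularPolynomial hz',
    eval_secularPolynomial fun k hk => hz' k (Finset.mem_filter.1 hk).1, Polynomial.eval_prod]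
  have h : secularSum s μ c z = secularSum (s.filter p) μ c z := by
    rw [secularSum, secularSum, Finset.sum_filter]
    refine Finset.sum_congr rfl fun k hk => ?_
    split_ifs with hp
    · rfl
    · rw [hc k hk hp, zero_div]
  rw [h, ← Finset.prod_filter_mul_prod_filter_not s p]
  simp only [Polynomial.eval_sub, Polynomial.eval_X, Polynomial.eval_C]
  ring

theorem sum_range_mul_sub_eq (q c : ℕ → ℂ) (M : ℕ) :
    ∑ j ∈ Finset.range M, q (j + 1) * (c j - c (j + 1)) =
      q 0 * c 0 - q M * c M + ∑ j ∈ Finset.range M, (q (j + 1) - q j) * c j := by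
  induction M with
  | zero => simp
  | succ M ih => rw [Finset.sum_range_succ, Finset.sum_range_succ, ih]; ring

theorem gridPoint_mem_Icc {l j : ℕ} (hj : j ≤ l + 1) : gridPoint l j ∈ Set.Icc 0 Real.pi := by
  have hpi := Real.pi_pos
  have hj' : (j : ℝ) ≤ l + 1 := by exact_mod_cast hj
  unfold gridPoint meshSize
  refine ⟨by positivity, ?_⟩
  rw [← mul_div_assoc, div_le_iff₀ (by positivity)]
  nlinarith

theorem norm_sum_mul_sin_le {q : ℝ → ℂ} {B L : ℝ} (hB : ∀ x ∈ Set.Icc 0 Real.pi, ‖q x‖ ≤ B)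
    (hL0 : 0 ≤ L) (hL : ∀ x ∈ Set.Icc 0 Real.pi, ∀ y ∈ Set.Icc 0 Real.pi, ‖q x - q y‖ ≤ L * |x - y|)
    (l k : ℕ) :
    ‖2 * (Real.sin (k * meshSize l / 2) : ℂ) *
        ∑ j ∈ Finset.Icc 1 l, q (gridPoint l j) * (Real.sin (k * gridPoint l j) : ℂ)‖ ≤
      2 * B + L * Real.pi := by
  set C : ℕ → ℂ := fun j => (Real.cos (k * gridPoint l j + k * meshSize l / 2) : ℂ) with hC
  have hC1 : ∀ j, ‖C j‖ ≤ 1 := fun j => by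
    rw [hC, Complex.norm_real]; exact Real.abs_cos_le_one _
  have h1 : 2 * (Real.sin (k * meshSize l / 2) : ℂ) *
      ∑ j ∈ Finset.Icc 1 l, q (gridPoint l j) * (Real.sin (k * gridPoint l j) : ℂ) =
      ∑ j ∈ Finset.range l, q (gridPoint l (j + 1)) * (C j - C (j + 1)) := by
    rw [← sum_fin_succ_eq_sum_Icc, Fin.sum_univ_eq_sum_range
      (fun j => q (gridPoint l (j + 1)) * (Real.sin (k * gridPoint l (j + 1)) : ℂ)) l,
      Finset.mul_sum]
    refine Finset.sum_congr rfl fun j _ => ?_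
    have h2 : (k : ℝ) * gridPoint l j + k * meshSize l / 2 =
        k * gridPoint l (j + 1) - k * meshSize l / 2 := by
      unfold gridPoint; push_cast; ring
    simp only [hC]
    rw [h2, Real.cos_sub, Real.cos_add]
    push_cast
    ring
  rw [h1, sum_range_mul_sub_eq (fun j => q (gridPoint l j)) C l]
  have hb : ∀ j, j ≤ l → ‖q (gridPoint l j) * C j‖ ≤ B := fun j hj => by
    rw [norm_mul]
    exact (mul_le_of_le_one_right (norm_nonneg _) (hC1 j)).trans
      (hB _ (gridPoint_mem_Icc (by omega)))
  have hs : ‖∑ j ∈ Finset.range l, (q (gridPoint l (j + 1)) - q (gridPoint l j)) * C j‖ ≤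
      L * Real.pi := by
    calc _ ≤ ∑ j ∈ Finset.range l, L * meshSize l := by
          refine norm_sum_le_of_le _ fun j hj => ?_
          rw [Finset.mem_range] at hj
          rw [norm_mul]
          refine (mul_le_of_le_one_right (norm_nonneg _) (hC1 j)).trans ?_
          refine (hL _ (gridPoint_mem_Icc (by omega)) _ (gridPoint_mem_Icc (by omega))).trans ?_
          have h3 : gridPoint l (j + 1) - gridPoint l j = meshSize l := by
            unfold gridPoint; push_cast; ring
          rw [h3, abs_of_pos (meshSize_pos l)]
      _ = L * gridPoint l l := by
          rw [Finset.sum_const, Finset.card_range, nsmul_eq_mul, gridPoint]; ring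
      _ ≤ _ := by
          gcongr
          exact (gridPoint_mem_Icc (by omega)).2
  refine (norm_add_le_of_le (norm_sub_le_of_le (hb 0 (by omega)) (hb l le_rfl)) hs).trans ?_
  linarith

theorem div_le_sin_mul_meshSize {l k : ℕ} (hk : k ≤ l + 1) :
    (k : ℝ) / (l + 1) ≤ Real.sin (k * meshSize l / 2) := by
  have hpi := Real.pi_pos
  have h := gridPoint_mem_Icc hk
  rw [gridPoint] at h
  refine le_trans (le_of_eq ?_) (Real.mul_le_sin (x := k * meshSize l / 2) (by linarith [h.1])
    (by linarith [h.2]))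
  unfold meshSize
  field_simp

theorem exists_norm_frozenCoeff_le {q : ℝ → ℂ} (hq : ContDiffOn ℝ 1 q (Set.Icc 0 Real.pi)) :
    ∃ K : ℝ, 0 ≤ K ∧ ∀ l m k : ℕ, 1 ≤ k → k ≤ l → ‖frozenCoeff q l m k‖ ≤ K / k := by
  have hpi := Real.pi_pos
  obtain ⟨L, hL⟩ := hq.exists_lipschitzOnWith one_ne_zero (convex_Icc _ _) isCompact_Icc
  obtain ⟨B, hB⟩ := isCompact_Icc.exists_bound_of_continuousOn hq.continuousOn
  have hB0 : 0 ≤ B := (norm_nonneg _).trans (hB 0 ⟨le_rfl, hpi.le⟩)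
  refine ⟨2 * B + L * Real.pi, by positivity, fun l m k hk hkl => ?_⟩
  have h := norm_sum_mul_sin_le hB L.2 (fun x hx y hy => by
    simpa [dist_eq_norm] using hL.dist_le_mul x hx y hy) l k
  have hs := div_le_sin_mul_meshSize (l := l) (k := k) (by omega)
  have hk0 : (0 : ℝ) < k := by exact_mod_cast hk
  rw [norm_mul, norm_mul, Complex.norm_real, Real.norm_eq_abs] at h
  rw [frozenCoeff, norm_mul, norm_mul, Complex.norm_real, Real.norm_eq_abs]
  set T := ‖∑ j ∈ Finset.Icc 1 l, q (gridPoint l j) * (Real.sin (k * gridPoint l j) : ℂ)‖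
  have hT : 0 ≤ T := norm_nonneg _
  have h2 : ‖(2 : ℂ) / ((l : ℂ) + 1)‖ = 2 / ((l : ℝ) + 1) := by
    rw [norm_div]
    have : (l : ℂ) + 1 = ((l + 1 : ℝ) : ℂ) := by push_cast; ring
    rw [this, Complex.norm_real, Real.norm_of_nonneg (by positivity)]
    simp
  rw [h2]
  refine (mul_le_of_le_one_right (by positivity) (Real.abs_sin_le_one _)).trans ?_
  rw [le_div_iff₀ hk0]
  refine le_trans ?_ h
  have : ‖(2 : ℂ)‖ = 2 := by simp
  rw [this]
  calc 2 / ((l : ℝ) + 1) * T * k = 2 * (k / ((l : ℝ) + 1)) * T := by ring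
    _ ≤ _ := by
      gcongr
      exact hs.trans (le_abs_self _)

theorem primedSum_add_reflect {m : ℕ} (hm : 1 ≤ m) {f : ℕ → ℂ} (h0 : f 0 = 0)
    (h1 : f (2 * m) = 0) :
    primedSum m (fun j => f j + f (2 * m - j)) = ∑ j ∈ Finset.Icc 1 (2 * m - 1), f j := by
  have hrefl : ∑ j ∈ Finset.Ioo 0 m, f (2 * m - j) = ∑ j ∈ Finset.Ioo m (2 * m), f j := by
    refine Finset.sum_nbij' (fun j => 2 * m - j) (fun j => 2 * m - j) ?_ ?_ ?_ ?_ ?_ <;>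
      intro j hj <;> simp only [Finset.mem_Ioo] at hj ⊢ <;> omega
  have hsplit : Finset.Icc 1 (2 * m - 1) = insert m (Finset.Ioo 0 m ∪ Finset.Ioo m (2 * m)) := by
    ext j
    simp only [Finset.mem_Icc, Finset.mem_insert, Finset.mem_union, Finset.mem_Ioo]
    omega
  rw [hsplit, Finset.sum_insert (by simp), Finset.sum_union
    (Finset.disjoint_left.2 fun j hj hj' => by simp only [Finset.mem_Ioo] at hj hj'; omega)]
  rw [primedSum, Finset.sum_add_distrib, hrefl]
  have : 2 * m - m = m := by omega
  rw [this, Nat.sub_zero, h0, h1]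
  ring

theorem meshSize_two_mul_sub_one {m : ℕ} (hm : 1 ≤ m) :
    meshSize (2 * m - 1) = Real.pi / (2 * m) := by
  rw [meshSize, Nat.cast_sub (by omega)]
  push_cast
  congr 1
  ring

theorem gridPoint_two_mul_sub {m j : ℕ} (hm : 1 ≤ m) (hj : j ≤ 2 * m) :
    gridPoint (2 * m - 1) (2 * m - j) = Real.pi - gridPoint (2 * m - 1) j := by
  have hm0 : (m : ℝ) ≠ 0 := by positivity
  rw [gridPoint, gridPoint, meshSize_two_mul_sub_one hm, Nat.cast_sub hj]
  push_cast
  field_simp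

theorem mul_primedSum_eq_frozenCoeff (q : ℝ → ℂ) {m n : ℕ} (hm : 1 ≤ m) (hn : Odd n) :
    ((2 / Real.pi * Real.sin ((n : ℝ) * Real.pi / 2) * meshSize (2 * m - 1) : ℝ) : ℂ) *
        primedSum m (fun j =>
          (q (gridPoint (2 * m - 1) j) + q (Real.pi - gridPoint (2 * m - 1) j)) *
            (Real.sin ((n : ℝ) * gridPoint (2 * m - 1) j) : ℂ)) =
      frozenCoeff q (2 * m - 1) m n := by
  have hpi := Real.pi_pos
  have hm0 : (0 : ℝ) < m := by exact_mod_cast hm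
  set f : ℕ → ℂ := fun j => q (gridPoint (2 * m - 1) j) *
    (Real.sin ((n : ℝ) * gridPoint (2 * m - 1) j) : ℂ) with hf
  have hsin : ∀ x : ℝ, Real.sin (n * (Real.pi - x)) = Real.sin (n * x) := fun x => by
    rw [mul_sub, Real.sin_nat_mul_pi_sub, hn.neg_one_pow]; ring
  have hreflect : ∀ j, j ≤ 2 * m → f (2 * m - j) = q (Real.pi - gridPoint (2 * m - 1) j) *
      (Real.sin ((n : ℝ) * gridPoint (2 * m - 1) j) : ℂ) := fun j hj => by
    simp only [hf]
    rw [gridPoint_two_mul_sub hm hj, hsin]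
  have hsum : primedSum m (fun j =>
      (q (gridPoint (2 * m - 1) j) + q (Real.pi - gridPoint (2 * m - 1) j)) *
        (Real.sin ((n : ℝ) * gridPoint (2 * m - 1) j) : ℂ)) =
      primedSum m (fun j => f j + f (2 * m - j)) := by
    have : ∀ j, j ≤ m → (q (gridPoint (2 * m - 1) j) + q (Real.pi - gridPoint (2 * m - 1) j)) *
        (Real.sin ((n : ℝ) * gridPoint (2 * m - 1) j) : ℂ) = f j + f (2 * m - j) := fun j hj => by
      rw [hreflect j (by omega), add_mul]
    simp only [primedSum]
    rw [this 0 (by omega), this m le_rfl, Finset.sum_congr rfl fun j hj =>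
      this j (Finset.mem_Ioo.1 hj).2.le]
  have h0 : f 0 = 0 := by simp [hf, gridPoint]
  have h1 : f (2 * m) = 0 := by
    have := hreflect 0 (by omega)
    rw [Nat.sub_zero] at this
    rw [this]
    simp [gridPoint]
  rw [hsum, primedSum_add_reflect hm h0 h1, frozenCoeff]
  have hx : (n : ℝ) * gridPoint (2 * m - 1) m = n * Real.pi / 2 := by
    rw [gridPoint, meshSize_two_mul_sub_one hm]
    field_simp
  have hcoef : ((2 / Real.pi * Real.sin ((n : ℝ) * Real.pi / 2) * meshSize (2 * m - 1) : ℝ) : ℂ) =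
      2 / (((2 * m - 1 : ℕ) : ℂ) + 1) * (Real.sin (n * Real.pi / 2) : ℂ) := by
    rw [meshSize_two_mul_sub_one hm]
    have h2 : ((2 * m - 1 : ℕ) : ℂ) + 1 = ((2 * m : ℝ) : ℂ) := by
      rw [Nat.cast_sub (by omega)]; push_cast; ring
    rw [h2]
    norm_cast
    push_cast
    field_simp
  rw [hx, hcoef]
  ring

theorem frozenCoeff_eq_zero_of_even (q : ℝ → ℂ) {m n : ℕ} (hm : 1 ≤ m) (hn : Even n) :
    frozenCoeff q (2 * m - 1) m n = 0 := by
  have hm0 : (m : ℝ) ≠ 0 := by positivity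
  obtain ⟨r, rfl⟩ := hn
  have hx : ((r + r : ℕ) : ℝ) * gridPoint (2 * m - 1) m = r * Real.pi := by
    rw [gridPoint, meshSize_two_mul_sub_one hm]
    push_cast
    field_simp
    ring
  rw [frozenCoeff, hx, Real.sin_nat_mul_pi, Complex.ofReal_zero, mul_zero]

theorem angleToEigenvalue_gridPoint (l k : ℕ) :
    angleToEigenvalue l (gridPoint l k : ℝ) = (freeEigenvalue l k : ℂ) := by
  rw [angleToEigenvalue, freeEigenvalue_eq, gridPoint]
  push_cast
  rfl

theorem sq_norm_sub_le_norm_angleToEigenvalue_sub {l k : ℕ} (hk : k ≤ l + 1) {θ : ℂ}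
    (hθ : θ.re ∈ Set.Icc 0 Real.pi) :
    4 / (Real.pi ^ 2 * meshSize l ^ 2) * ‖θ - (gridPoint l k : ℝ)‖ ^ 2 ≤
      ‖angleToEigenvalue l θ - (freeEigenvalue l k : ℂ)‖ := by
  have hpi := Real.pi_pos
  have hh := meshSize_pos l
  have h := sq_norm_sub_le_norm_cos_sub_cos hθ (gridPoint_mem_Icc hk)
  have h1 : angleToEigenvalue l θ - (freeEigenvalue l k : ℂ) =
      -(2 / (meshSize l : ℂ) ^ 2) * (Complex.cos θ - Complex.cos (gridPoint l k : ℝ)) := by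
    rw [← angleToEigenvalue_gridPoint, angleToEigenvalue, angleToEigenvalue]
    ring
  have h2 : ‖-(2 / (meshSize l : ℂ) ^ 2)‖ = 2 / meshSize l ^ 2 := by
    rw [norm_neg, norm_div, norm_pow, Complex.norm_real, Real.norm_of_nonneg hh.le]
    simp
  rw [h1, norm_mul, h2]
  calc _ = 2 / meshSize l ^ 2 * (2 / Real.pi ^ 2 * ‖θ - (gridPoint l k : ℝ)‖ ^ 2) := by
        field_simp
        ring
    _ ≤ _ := by gcongr

theorem pi_sq_lt_ten : Real.pi ^ 2 < 10 := by
  nlinarith [Real.pi_lt_d2, Real.pi_pos]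

theorem gridPoint_sub (l n k : ℕ) :
    gridPoint l n - gridPoint l k = ((n : ℝ) - k) * meshSize l := by
  unfold gridPoint; ring

theorem sq_sub_le_norm_freeEigenvalue_sub {l n k : ℕ} (hn : n ≤ l + 1) (hk : k ≤ l + 1) :
    2 / 5 * ((k : ℝ) - n) ^ 2 ≤ ‖(freeEigenvalue l n : ℂ) - (freeEigenvalue l k : ℂ)‖ := by
  have hpi := Real.pi_pos
  have hh := meshSize_pos l
  have h := sq_norm_sub_le_norm_angleToEigenvalue_sub hk (θ := (gridPoint l n : ℝ))
    (gridPoint_mem_Icc hn)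
  rw [angleToEigenvalue_gridPoint, ← Complex.ofReal_sub (gridPoint l n), Complex.norm_real,
    Real.norm_eq_abs, sq_abs, gridPoint_sub] at h
  refine le_trans ?_ h
  have : 4 / (Real.pi ^ 2 * meshSize l ^ 2) * (((n : ℝ) - k) * meshSize l) ^ 2 =
      4 / Real.pi ^ 2 * ((k : ℝ) - n) ^ 2 := by
    field_simp
    ring
  rw [this]
  refine mul_le_mul_of_nonneg_right ?_ (sq_nonneg _)
  rw [div_le_div_iff₀ (by norm_num) (by positivity)]
  linarith [pi_sq_lt_ten]

theorem one_le_sq_sub {k n : ℕ} (h : k ≠ n) : (1 : ℝ) ≤ ((k : ℝ) - n) ^ 2 := by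
  have h1 : (1 : ℤ) ≤ |(k : ℤ) - n| := Int.one_le_abs (by omega)
  have h2 : (1 : ℝ) ≤ |(k : ℝ) - n| := by exact_mod_cast h1
  rw [← sq_abs]
  exact one_le_pow₀ h2

theorem sq_sub_le_norm_sub_freeEigenvalue {l n k : ℕ} (hn : n ≤ l + 1) (hk : k ≤ l + 1)
    (hkn : k ≠ n) {z : ℂ} (hz : ‖z - (freeEigenvalue l n : ℂ)‖ ≤ 1 / 10) :
    1 / 5 * ((k : ℝ) - n) ^ 2 ≤ ‖z - (freeEigenvalue l k : ℂ)‖ := by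
  have h1 := sq_sub_le_norm_freeEigenvalue_sub hn hk
  have h2 := one_le_sq_sub hkn
  have h3 : ‖(freeEigenvalue l n : ℂ) - (freeEigenvalue l k : ℂ)‖ ≤
      ‖z - (freeEigenvalue l n : ℂ)‖ + ‖z - (freeEigenvalue l k : ℂ)‖ := by
    rw [norm_sub_rev z]
    exact norm_sub_le_norm_sub_add_norm_sub _ _ _
  linarith

theorem eventually_const_div_lt (A : ℝ) {ε : ℝ} (hε : 0 < ε) :
    ∀ᶠ n : ℕ in Filter.atTop, A / n < ε :=
  (tendsto_const_div_atTop_nhds_zero_nat A).eventually_lt_const hε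

/-- The odd indices in `1, …, l`; the other eigenvalues do not depend on the potential. -/
def oddIndices (l : ℕ) : Finset ℕ := (Finset.Icc 1 l).filter Odd

/-- The factor of the characteristic polynomial that depends on the potential. -/
noncomputable def oddFactor (q : ℝ → ℂ) (l m : ℕ) : Polynomial ℂ :=
  secularPolynomial (oddIndices l) (fun k => (freeEigenvalue l k : ℂ)) (frozenCoeff q l m)

theorem mem_oddIndices {l n : ℕ} : n ∈ oddIndices l ↔ (1 ≤ n ∧ n ≤ l) ∧ Odd n := by
  simp [oddIndices]

theorem exists_simple_root_oddFactor {q : ℝ → ℂ} {K : ℝ} (hK0 : 0 ≤ K)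
    (hK : ∀ l m k : ℕ, 1 ≤ k → k ≤ l → ‖frozenCoeff q l m k‖ ≤ K / k) :
    ∃ N : ℕ, ∀ l m n : ℕ, n ∈ oddIndices l → N ≤ n →
      ∃ z, ‖z - (freeEigenvalue l n : ℂ)‖ ≤ 1 / 20 ∧
        ‖z - (freeEigenvalue l n : ℂ)‖ ≤ 2 * ‖frozenCoeff q l m n‖ ∧
        ‖z - ((freeEigenvalue l n : ℂ) + frozenCoeff q l m n)‖ ≤ ‖frozenCoeff q l m n‖ ∧
        (oddFactor q l m).rootMultiplicity z = 1 ∧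
        ∀ w, ‖w - (freeEigenvalue l n : ℂ)‖ ≤ 1 / 10 → (oddFactor q l m).IsRoot w → w = z := by
  obtain ⟨N, hN⟩ := Filter.eventually_atTop.1
    ((eventually_const_div_lt (2 * intInvSqSum * K / (1 / 5)) (ε := 1 / 3) (by norm_num)).and
      (eventually_const_div_lt K (ε := 1 / 40) (by norm_num)))
  refine ⟨N, fun l m n hn hNn => ?_⟩
  obtain ⟨h1, h2⟩ := hN n hNn
  obtain ⟨⟨hn1, hnl⟩, -⟩ := mem_oddIndices.1 hn
  have hsep : ∀ z ∈ Metric.closedBall (freeEigenvalue l n : ℂ) (1 / 10),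
      ∀ k ∈ (oddIndices l).erase n,
        1 / 5 * ((k : ℝ) - n) ^ 2 ≤ ‖z - (freeEigenvalue l k : ℂ)‖ := by
    intro z hz k hk
    obtain ⟨hkn, hk⟩ := Finset.mem_erase.1 hk
    obtain ⟨⟨-, hkl⟩, -⟩ := mem_oddIndices.1 hk
    rw [Metric.mem_closedBall, dist_eq_norm] at hz
    exact sq_sub_le_norm_sub_freeEigenvalue (by omega) (by omega) hkn hz
  have hcn := (hK l m n hn1 hnl).trans h2.le
  obtain ⟨z, hz1, hz2, hz3, hz4⟩ := exists_simple_root_secularPolynomial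
    (μ := fun k => (freeEigenvalue l k : ℂ)) (c := frozenCoeff q l m) (r := 1 / 10) (b := 1 / 5)
    (ε := 1 / 3) hn (by norm_num) (by norm_num)
    (fun z hz k hk => le_trans (by linarith [one_le_sq_sub (Finset.mem_erase.1 hk).1])
      (hsep z hz k hk))
    (fun z hz => (sum_norm_div_norm_sub_le (fun k hk => (mem_oddIndices.1 hk).1.1) hn1
      (by norm_num) hK0 (fun k hk => hK l m k (mem_oddIndices.1 hk).1.1 (mem_oddIndices.1 hk).1.2)
      (hsep z hz)).trans h1.le)
    (by norm_num) (by linarith)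
  refine ⟨z, by linarith, hz1, hz2, hz3, fun w hw => hz4 w ?_⟩
  rwa [Metric.mem_closedBall, dist_eq_norm]

theorem exists_map_eq_of_card_eq {α β : Type*} [DecidableEq α] [Inhabited β] (s : Finset α)
    (R : Multiset β) (h : R.card = s.card) : ∃ g : α → β, s.val.map g = R := by
  induction s using Finset.induction_on generalizing R with
  | empty => exact ⟨fun _ => default, by simpa [eq_comm] using h⟩
  | insert a s ha ih =>
    rw [Finset.card_insert_of_notMem ha] at h
    obtain ⟨x, hx⟩ := Multiset.card_pos_iff_exists_mem.1 (by omega : 0 < R.card)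
    obtain ⟨R', rfl⟩ := Multiset.exists_cons_of_mem hx
    obtain ⟨g, rfl⟩ := ih R' (by simpa using h)
    refine ⟨Function.update g a x, ?_⟩
    rw [Finset.insert_val_of_notMem ha, Multiset.map_cons, Function.update_self]
    congr 1
    refine Multiset.map_congr rfl fun b hb => Function.update_of_ne ?_ _ _
    rintro rfl
    exact ha hb

theorem exists_map_eq_extending {α β : Type*} [DecidableEq α] [DecidableEq β] [Inhabited β]
    {s t : Finset α} (hts : t ⊆ s) {R : Multiset β} (hcard : R.card = s.card) {ρ : α → β}
    (hinj : Set.InjOn ρ t) (hmem : ∀ a ∈ t, ρ a ∈ R) :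
    ∃ g : α → β, s.val.map g = R ∧ ∀ a ∈ t, g a = ρ a := by
  have hle : t.val.map ρ ≤ R := by
    rw [Multiset.le_iff_subset (Multiset.Nodup.map_on (fun a ha b hb h => hinj ha hb h) t.nodup)]
    intro b hb
    obtain ⟨a, ha, rfl⟩ := Multiset.mem_map.1 hb
    exact hmem a ha
  obtain ⟨R', rfl⟩ := Multiset.le_iff_exists_add.1 hle
  obtain ⟨g, hg⟩ := exists_map_eq_of_card_eq (s \ t) R' (by
    rw [Finset.card_sdiff_of_subset hts, ← hcard]
    simp)
  refine ⟨fun a => if a ∈ t then ρ a else g a, ?_, fun a ha => if_pos ha⟩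
  have hs : s.val = t.val + (s \ t).val := by
    rw [Finset.sdiff_val, add_tsub_cancel_of_le (Finset.val_le_iff.2 hts)]
  rw [hs, Multiset.map_add, ← hg]
  congr 1
  · exact Multiset.map_congr rfl fun a ha => if_pos ha
  · exact Multiset.map_congr rfl fun a ha => if_neg (Finset.mem_sdiff.1 ha).2

theorem charpoly_frozenOperator_eq_oddFactor_mul (q : ℝ → ℂ) {m : ℕ} (hm : 1 ≤ m) :
    (frozenOperator q (2 * m - 1) m).charpoly = oddFactor q (2 * m - 1) m *
      ∏ k ∈ (Finset.Icc 1 (2 * m - 1)).filter (fun k => ¬ Odd k),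
        (Polynomial.X - Polynomial.C (freeEigenvalue (2 * m - 1) k : ℂ)) := by
  rw [charpoly_frozenOperator q (by omega), oddFactor, oddIndices]
  exact secularPolynomial_filter Odd fun k _ hk =>
    frozenCoeff_eq_zero_of_even q hm (Nat.not_odd_iff_even.1 hk)

theorem roots_charpoly_frozenOperator (q : ℝ → ℂ) {m : ℕ} (hm : 1 ≤ m) :
    (frozenOperator q (2 * m - 1) m).charpoly.roots = (oddFactor q (2 * m - 1) m).roots +
      ((Finset.Icc 1 (2 * m - 1)).filter (fun k => ¬ Odd k)).val.map
        (fun k => (freeEigenvalue (2 * m - 1) k : ℂ)) := by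
  have h := charpoly_frozenOperator_eq_oddFactor_mul q hm
  have hne := (frozenOperator q (2 * m - 1) m).charpoly_monic.ne_zero
  rw [h] at hne
  rw [h, Polynomial.roots_mul hne]
  congr 1
  convert Polynomial.roots_multiset_prod_X_sub_C
    (((Finset.Icc 1 (2 * m - 1)).filter (fun k => ¬ Odd k)).val.map
        (fun k => (freeEigenvalue (2 * m - 1) k : ℂ))) using 2
  rw [Multiset.map_map]
  rfl

theorem card_roots_oddFactor (q : ℝ → ℂ) {m : ℕ} (hm : 1 ≤ m) :
    (oddFactor q (2 * m - 1) m).roots.card = (oddIndices (2 * m - 1)).card := by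
  have h := congrArg Multiset.card (roots_charpoly_frozenOperator q hm)
  rw [Polynomial.splits_iff_card_roots.1 (IsAlgClosed.splits _), LinearMap.charpoly_natDegree,
    Module.finrank_fin_fun, Multiset.card_add, Multiset.card_map] at h
  have h2 := Finset.card_filter_add_card_filter_not (s := Finset.Icc 1 (2 * m - 1)) Odd
  rw [Nat.card_Icc] at h2
  simp only [Finset.card_val] at h
  rw [oddIndices]
  omega

theorem exists_enumeration {q : ℝ → ℂ} {K : ℝ} (hK0 : 0 ≤ K)
    (hK : ∀ l m k : ℕ, 1 ≤ k → k ≤ l → ‖frozenCoeff q l m k‖ ≤ K / k) :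
    ∃ N : ℕ, ∀ m : ℕ, 1 ≤ m → ∃ Λ : ℕ → ℂ,
      EnumeratesEigenvalues q (2 * m - 1) m Λ ∧
      (∀ n, Even n → Λ n = (freeEigenvalue (2 * m - 1) n : ℂ)) ∧
      (∀ k ∈ oddIndices (2 * m - 1), (oddFactor q (2 * m - 1) m).IsRoot (Λ k)) ∧
      ∀ n ∈ oddIndices (2 * m - 1), N ≤ n →
        ‖Λ n - (freeEigenvalue (2 * m - 1) n : ℂ)‖ ≤ 2 * ‖frozenCoeff q (2 * m - 1) m n‖ ∧
        ‖Λ n - ((freeEigenvalue (2 * m - 1) n : ℂ) + frozenCoeff q (2 * m - 1) m n)‖ ≤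
          ‖frozenCoeff q (2 * m - 1) m n‖ ∧
        ∀ k ∈ oddIndices (2 * m - 1),
          ‖Λ k - (freeEigenvalue (2 * m - 1) n : ℂ)‖ ≤ 1 / 10 → k = n := by
  classical
  obtain ⟨N, hN⟩ := exists_simple_root_oddFactor hK0 hK
  refine ⟨N, fun m hm => ?_⟩
  set l := 2 * m - 1 with hl
  set P := oddFactor q l m with hP
  choose! ρ hρ1 hρ2 hρ3 hρ4 hρ5 using hN l m
  have hP0 : P ≠ 0 := fun h0 => by
    have h := charpoly_frozenOperator_eq_oddFactor_mul q hm
    rw [← hl, ← hP, h0, zero_mul] at h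
    exact (frozenOperator q l m).charpoly_monic.ne_zero h
  have hinj : Set.InjOn ρ ((oddIndices l).filter (N ≤ ·)) := by
    intro n hn k hk h
    obtain ⟨hn, hNn⟩ := Finset.mem_filter.1 (Finset.mem_coe.1 hn)
    obtain ⟨hk, hNk⟩ := Finset.mem_filter.1 (Finset.mem_coe.1 hk)
    by_contra hne
    have h1 := hρ1 n hn hNn
    have h2 := hρ1 k hk hNk
    have h3 := sq_sub_le_norm_sub_freeEigenvalue (l := l) (n := n) (k := k)
      (by have := mem_oddIndices.1 hn; omega) (by have := mem_oddIndices.1 hk; omega) (Ne.symm hne)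
      (h1.trans (by norm_num))
    rw [h] at h3
    linarith [one_le_sq_sub (Ne.symm hne)]
  obtain ⟨g, hg, hgρ⟩ := exists_map_eq_extending (Finset.filter_subset (N ≤ ·) (oddIndices l))
    (card_roots_oddFactor q hm) hinj (fun n hn => by
      obtain ⟨hn, hNn⟩ := Finset.mem_filter.1 hn
      rw [← hl, ← hP, ← Multiset.count_pos, Polynomial.count_roots, hρ4 n hn hNn]
      exact one_pos)
  rw [← hl, ← hP] at hg
  set Λ : ℕ → ℂ := fun n => if Odd n then g n else (freeEigenvalue l n : ℂ) with hΛ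
  have hodd : ∀ k ∈ oddIndices l, Λ k = g k := fun k hk => if_pos (mem_oddIndices.1 hk).2
  have hmap : (oddIndices l).val.map Λ = P.roots := by
    rw [← hg]
    exact Multiset.map_congr rfl hodd
  have hroot : ∀ k ∈ oddIndices l, P.IsRoot (Λ k) := fun k hk =>
    Polynomial.isRoot_of_mem_roots (hmap ▸ Multiset.mem_map_of_mem Λ hk)
  refine ⟨Λ, ?_, fun n hn => if_neg (Nat.not_odd_iff_even.2 hn), hroot, fun n hn hNn => ?_⟩
  · rw [EnumeratesEigenvalues, roots_charpoly_frozenOperator q hm, ← hl, ← hP, ← hmap]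
    have hs : (Finset.Icc 1 l).val =
        (oddIndices l).val + ((Finset.Icc 1 l).filter (fun k => ¬ Odd k)).val := by
      rw [oddIndices, Finset.filter_val, Finset.filter_val, Multiset.filter_add_not]
    rw [hs, Multiset.map_add]
    congr 1
    refine Multiset.map_congr rfl fun k hk => ?_
    have hk' : ¬ Odd k := by
      have h := Finset.mem_def.2 hk
      exact (Finset.mem_filter.1 h).2
    exact (if_neg hk').symm
  · have hΛρ : Λ n = ρ n := (hodd n hn).trans (hgρ n (Finset.mem_filter.2 ⟨hn, hNn⟩))
    refine ⟨hΛρ ▸ hρ2 n hn hNn, hΛρ ▸ hρ3 n hn hNn, fun k hk hkn => ?_⟩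
    have hkρ := hρ5 n hn hNn _ hkn (hroot k hk)
    have hcount : ((oddIndices l).filter (fun j => ρ n = Λ j)).card ≤ 1 := by
      rw [← hρ4 n hn hNn, ← Polynomial.count_roots, ← hP, ← hmap, Multiset.count_map]
      rfl
    exact Finset.card_le_one.1 hcount k (Finset.mem_filter.2 ⟨hk, hkρ.symm⟩) n
      (Finset.mem_filter.2 ⟨hn, hΛρ.symm⟩)

theorem discRadius_lt {m : ℕ} (hm : 2 ≤ m) {δ : ℝ} (hδ : δ < Real.pi / 2) :
    δ / ((2 * m - 1 : ℕ) : ℝ) < 2 / 3 * meshSize (2 * m - 1) := by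
  have hm' : (2 : ℝ) ≤ m := by exact_mod_cast hm
  have hpi := Real.pi_pos
  rw [meshSize_two_mul_sub_one (by omega), Nat.cast_sub (by omega)]
  push_cast
  have h1 : (0 : ℝ) < 2 * m - 1 := by linarith
  rw [div_lt_iff₀ h1]
  have : 2 / 3 * (Real.pi / (2 * m)) * (2 * m - 1) - Real.pi / 2 =
      Real.pi * (m - 2) / (6 * m) := by
    field_simp
    ring
  have h2 : 0 ≤ Real.pi * (m - 2) / (6 * m) := by
    have : (0 : ℝ) ≤ m - 2 := by linarith
    positivity
  linarith

theorem discCenter_eq {m n : ℕ} (hm : 1 ≤ m) :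
    Real.pi * (n : ℝ) / (2 * (m : ℝ)) = gridPoint (2 * m - 1) n := by
  rw [gridPoint, meshSize_two_mul_sub_one hm]
  ring

theorem re_mem_Ioo_of_norm_sub_gridPoint_lt {l n : ℕ} (hn1 : 1 ≤ n) (hnl : n ≤ l) {θ : ℂ}
    (hθ : ‖θ - (gridPoint l n : ℝ)‖ < 2 / 3 * meshSize l) : θ.re ∈ Set.Ioo 0 Real.pi := by
  have hh := meshSize_pos l
  have h1 := (Complex.abs_re_le_norm (θ - (gridPoint l n : ℝ))).trans_lt hθ
  rw [Complex.sub_re, Complex.ofReal_re, abs_lt] at h1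
  have h2 : meshSize l ≤ gridPoint l n := by
    have : (1 : ℝ) ≤ n := by exact_mod_cast hn1
    rw [gridPoint]
    nlinarith
  have h3 : gridPoint l n + meshSize l ≤ Real.pi := by
    have := (gridPoint_mem_Icc (l := l) (j := n + 1) (by omega)).2
    rw [gridPoint] at this ⊢
    push_cast at this
    linarith
  constructor <;> linarith [h1.1, h1.2]

theorem sq_sub_le_norm_angleToEigenvalue_sub {l n k : ℕ} (hn1 : 1 ≤ n) (hnl : n ≤ l)
    (hk : k ≤ l + 1) (hkn : k ≠ n) {θ : ℂ}
    (hθ : ‖θ - (gridPoint l n : ℝ)‖ < 2 / 3 * meshSize l) :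
    1 / 25 * ((k : ℝ) - n) ^ 2 ≤ ‖angleToEigenvalue l θ - (freeEigenvalue l k : ℂ)‖ := by
  have hpi := Real.pi_pos
  have hh := meshSize_pos l
  have h := re_mem_Ioo_of_norm_sub_gridPoint_lt hn1 hnl hθ
  refine le_trans ?_ (sq_norm_sub_le_norm_angleToEigenvalue_sub hk ⟨h.1.le, h.2.le⟩)
  have h1 : |(k : ℝ) - n| * meshSize l ≤
      ‖θ - (gridPoint l n : ℝ)‖ + ‖θ - (gridPoint l k : ℝ)‖ := by
    have h2 : ‖((gridPoint l n : ℝ) : ℂ) - (gridPoint l k : ℝ)‖ = |(k : ℝ) - n| * meshSize l := by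
      rw [← Complex.ofReal_sub, Complex.norm_real, gridPoint_sub, Real.norm_eq_abs, abs_mul,
        abs_of_pos hh, abs_sub_comm]
    rw [← h2, norm_sub_rev θ]
    exact norm_sub_le_norm_sub_add_norm_sub _ _ _
  have h3 : 1 ≤ |(k : ℝ) - n| := by
    have := one_le_sq_sub hkn
    exact (one_le_sq_iff_one_le_abs _).1 this
  have h4 : 1 / 3 * (|(k : ℝ) - n| * meshSize l) ≤ ‖θ - (gridPoint l k : ℝ)‖ := by
    nlinarith
  calc 1 / 25 * ((k : ℝ) - n) ^ 2 ≤ 4 / (9 * Real.pi ^ 2) * ((k : ℝ) - n) ^ 2 := by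
        refine mul_le_mul_of_nonneg_right ?_ (sq_nonneg _)
        rw [div_le_div_iff₀ (by norm_num) (by positivity)]
        linarith [pi_sq_lt_ten]
    _ = 4 / (Real.pi ^ 2 * meshSize l ^ 2) * (1 / 3 * (|(k : ℝ) - n| * meshSize l)) ^ 2 := by
        rw [mul_pow, mul_pow, sq_abs]
        field_simp
        ring
    _ ≤ _ := by gcongr

theorem exists_angle_of_norm_sub_freeEigenvalue_lt {l n : ℕ} (hl : 1 ≤ l) (hnl : n ≤ l + 1) {δ : ℝ}
    (hδ : 0 < δ) {z : ℂ} (hz : ‖z - (freeEigenvalue l n : ℂ)‖ < 4 * δ ^ 2 / Real.pi ^ 4) :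
    ∃ θ : ℂ, ‖θ - (gridPoint l n : ℝ)‖ < δ / l ∧ z = angleToEigenvalue l θ := by
  have hpi := Real.pi_pos
  have hh := meshSize_pos l
  obtain ⟨θ, hcos, hθ⟩ := exists_cos_eq_of_re_mem_Icc (1 - (meshSize l : ℂ) ^ 2 * z / 2)
  have hzθ : z = angleToEigenvalue l θ := by
    have : (meshSize l : ℂ) ≠ 0 := by exact_mod_cast hh.ne'
    rw [angleToEigenvalue, hcos]
    field_simp
    ring
  refine ⟨θ, ?_, hzθ⟩
  have h := (sq_norm_sub_le_norm_angleToEigenvalue_sub hnl hθ).trans_lt (hzθ ▸ hz)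
  have hl0 : (0 : ℝ) < l := by exact_mod_cast hl
  have h1 : ‖θ - (gridPoint l n : ℝ)‖ ^ 2 < (δ * meshSize l / Real.pi) ^ 2 := by
    have h2 : 0 < 4 / (Real.pi ^ 2 * meshSize l ^ 2) := by positivity
    refine lt_of_mul_lt_mul_left (h.trans_eq ?_) h2.le
    field_simp
  refine (lt_of_pow_lt_pow_left₀ 2 (by positivity) h1).trans ?_
  rw [meshSize]
  have : δ * (Real.pi / ((l : ℝ) + 1)) / Real.pi = δ / (l + 1) := by field_simp
  rw [this]
  gcongr
  linarith

theorem exists_forall_le_of_le_div (N : ℕ) {α : ℝ} (hα : 0 < α) :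
    ∃ M : ℕ, 2 ≤ M ∧ ∀ m n : ℕ, M ≤ m → α ≤ (n : ℝ) / (2 * m) → N ≤ n := by
  refine ⟨⌈(N : ℝ) / α⌉₊ + 2, by omega, fun m n hm h => ?_⟩
  have h1 : (N : ℝ) / α ≤ m := (Nat.le_ceil _).trans (by exact_mod_cast (by omega))
  have hm0 : (0 : ℝ) < m := by exact_mod_cast (by omega : 0 < m)
  rw [div_le_iff₀ hα] at h1
  rw [le_div_iff₀ (by positivity)] at h
  have h2 : (N : ℝ) ≤ n := by nlinarith
  exact_mod_cast h2

theorem mainTheorem4 (q : ℝ → ℂ) (hq : ContDiffOn ℝ 1 q (Set.Icc 0 Real.pi)) :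
    ∃ Λ : ℕ → ℕ → ℂ,
      -- for each `m ≥ 1`, with `l = 2 m - 1`, the numbers `Λ m 1, …, Λ m l` are the eigenvalues,
      -- and those with even indices are the degenerate ones
      (∀ m : ℕ, 1 ≤ m → EnumeratesEigenvalues q (2 * m - 1) m (Λ m) ∧
        ∀ n ∈ Finset.Icc 1 (2 * m - 1), Even n →
          Λ m n = (freeEigenvalue (2 * m - 1) n : ℂ)) ∧
      ∀ α : ℝ, 0 < α →
        -- the numbering: `Λ m n` is the only eigenvalue, and a simple one, whose angle lies in
        -- the disc of radius `δ / l` around `π n / (2 m)`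
        (∀ δ : ℝ, 0 < δ → δ < Real.pi / 2 →
          ∃ M : ℕ, ∀ m : ℕ, M ≤ m → ∀ n ∈ Finset.Icc 1 (2 * m - 1), Odd n →
            α ≤ (n : ℝ) / (2 * (m : ℝ)) →
            ∃ θ ∈ Metric.ball ((Real.pi * (n : ℝ) / (2 * (m : ℝ)) : ℝ) : ℂ)
                (δ / ((2 * m - 1 : ℕ) : ℝ)),
              Λ m n = angleToEigenvalue (2 * m - 1) θ ∧
              ∀ k ∈ Finset.Icc 1 (2 * m - 1),
                ∀ θ' ∈ Metric.ball ((Real.pi * (n : ℝ) / (2 * (m : ℝ)) : ℝ) : ℂ)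
                    (δ / ((2 * m - 1 : ℕ) : ℝ)),
                  Λ m k = angleToEigenvalue (2 * m - 1) θ' → k = n ∧ θ' = θ) ∧
        -- the asymptotics, uniform in `n`
        (∃ C : ℝ, ∃ M : ℕ, ∀ m : ℕ, M ≤ m → ∀ n ∈ Finset.Icc 1 (2 * m - 1), Odd n →
          α ≤ (n : ℝ) / (2 * (m : ℝ)) →
          ‖Λ m n - ((freeEigenvalue (2 * m - 1) n : ℂ)
              + ((2 / Real.pi * Real.sin ((n : ℝ) * Real.pi / 2) * meshSize (2 * m - 1) : ℝ) : ℂ)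
                * primedSum m (fun j =>
                    (q (gridPoint (2 * m - 1) j) + q (Real.pi - gridPoint (2 * m - 1) j))
                      * (Real.sin ((n : ℝ) * gridPoint (2 * m - 1) j) : ℂ)))‖
            ≤ C * meshSize (2 * m - 1)) := by
  have hpi := Real.pi_pos
  obtain ⟨K, hK0, hK⟩ := exists_norm_frozenCoeff_le hq
  obtain ⟨N, hN⟩ := exists_enumeration hK0 hK
  choose! Λ hΛenum hΛeven hΛroot hΛ using hN
  refine ⟨Λ, fun m hm => ⟨hΛenum m hm, fun n _ hn => hΛeven m hm n hn⟩, fun α hα => ⟨?_, ?_⟩⟩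
  · intro δ hδ hδ2
    obtain ⟨N', hN'⟩ := Filter.eventually_atTop.1
      (((eventually_const_div_lt (2 * intInvSqSum * K / (1 / 25)) (ε := 1 / 2) (by norm_num)).and
        (eventually_const_div_lt K (ε := 1 / 20) (by norm_num))).and
        (eventually_const_div_lt K (ε := 2 * δ ^ 2 / Real.pi ^ 4) (by positivity)))
    obtain ⟨M, hM2, hM⟩ := exists_forall_le_of_le_div (max N N') hα
    refine ⟨M, fun m hm n hn hodd hαn => ?_⟩
    have hNn := hM m n hm hαn
    obtain ⟨⟨hsum, hK1⟩, hK2⟩ := hN' n (le_of_max_le_right hNn)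
    have hm1 : 1 ≤ m := by omega
    obtain ⟨hn1, hnl⟩ := Finset.mem_Icc.1 hn
    have hnmem : n ∈ oddIndices (2 * m - 1) := mem_oddIndices.2 ⟨⟨hn1, hnl⟩, hodd⟩
    obtain ⟨hΛ1, -, hΛ3⟩ := hΛ m hm1 n hnmem (le_of_max_le_left hNn)
    have hcn := hK (2 * m - 1) m n hn1 hnl
    simp only [discCenter_eq hm1, Metric.mem_ball, dist_eq_norm]
    have hrad := discRadius_lt (by omega : 2 ≤ m) hδ2
    have hlt : ‖Λ m n - (freeEigenvalue (2 * m - 1) n : ℂ)‖ < 4 * δ ^ 2 / Real.pi ^ 4 := by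
      have : 4 * δ ^ 2 / Real.pi ^ 4 = 2 * (2 * δ ^ 2 / Real.pi ^ 4) := by ring
      linarith
    obtain ⟨θ, hθ, hΛθ⟩ := exists_angle_of_norm_sub_freeEigenvalue_lt (by omega) (by omega) hδ hlt
    refine ⟨θ, hθ, hΛθ, fun k hk θ' hθ' hkθ' => ?_⟩
    obtain ⟨hk1, hkl⟩ := Finset.mem_Icc.1 hk
    have hsep : ∀ j, j ≤ 2 * m - 1 → j ≠ n → 1 / 25 * ((j : ℝ) - n) ^ 2 ≤
        ‖Λ m k - (freeEigenvalue (2 * m - 1) j : ℂ)‖ := fun j hj hjn => by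
      rw [hkθ']
      exact sq_sub_le_norm_angleToEigenvalue_sub hn1 hnl (by omega) hjn (hθ'.trans hrad)
    have hkn : k = n := by
      rcases Nat.even_or_odd k with hke | hko
      · by_contra hkn
        have h := hsep k hkl hkn
        rw [hΛeven m hm1 k hke, sub_self, norm_zero] at h
        linarith [one_le_sq_sub hkn]
      · have hkmem : k ∈ oddIndices (2 * m - 1) := mem_oddIndices.2 ⟨⟨hk1, hkl⟩, hko⟩
        have hsep' : ∀ j ∈ (oddIndices (2 * m - 1)).erase n, 1 / 25 * ((j : ℝ) - n) ^ 2 ≤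
            ‖Λ m k - (freeEigenvalue (2 * m - 1) j : ℂ)‖ := fun j hj => by
          obtain ⟨hjn, hj⟩ := Finset.mem_erase.1 hj
          exact hsep j (mem_oddIndices.1 hj).1.2 hjn
        have hloc := (norm_sub_le_of_isRoot_secularPolynomial hnmem
          (fun j hj h => by
            have := hsep' j hj
            rw [h, sub_self, norm_zero] at this
            linarith [one_le_sq_sub (Finset.mem_erase.1 hj).1])
          ((sum_norm_div_norm_sub_le (fun j hj => (mem_oddIndices.1 hj).1.1) hn1 (by norm_num) hK0
            (fun j hj => hK _ m j (mem_oddIndices.1 hj).1.1 (mem_oddIndices.1 hj).1.2)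
            hsep').trans hsum.le) (hΛroot m hm1 k hkmem)).1
        exact hΛ3 k hkmem (by linarith)
    refine ⟨hkn, ?_⟩
    subst hkn
    refine eq_of_cos_eq_of_re_mem_Ioo (re_mem_Ioo_of_norm_sub_gridPoint_lt hn1 hnl (hθ'.trans hrad))
      (re_mem_Ioo_of_norm_sub_gridPoint_lt hn1 hnl (hθ.trans hrad)) ?_
    have h := hkθ'.symm.trans hΛθ
    have hh : (meshSize (2 * m - 1) : ℂ) ^ 2 ≠ 0 := by
      exact_mod_cast (pow_pos (meshSize_pos _) 2).ne'
    rw [angleToEigenvalue, angleToEigenvalue, div_left_inj' hh] at h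
    linear_combination -h / 2
  · obtain ⟨M, hM2, hM⟩ := exists_forall_le_of_le_div N hα
    refine ⟨K / (Real.pi * α), M, fun m hm n hn hodd hαn => ?_⟩
    have hm1 : 1 ≤ m := by omega
    have hm0 : (0 : ℝ) < m := by exact_mod_cast hm1
    obtain ⟨hn1, hnl⟩ := Finset.mem_Icc.1 hn
    rw [mul_primedSum_eq_frozenCoeff q hm1 hodd]
    refine ((hΛ m hm1 n (mem_oddIndices.2 ⟨⟨hn1, hnl⟩, hodd⟩) (hM m n hm hαn)).2.1.trans
      (hK _ m n hn1 hnl)).trans ?_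
    rw [le_div_iff₀ (by positivity)] at hαn
    calc K / n ≤ K / (α * (2 * m)) := by gcongr
      _ = K / (Real.pi * α) * meshSize (2 * m - 1) := by
        rw [meshSize_two_mul_sub_one hm1]
        field_simp
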